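/- **Setting.** Let $X$ and $D$ be Banach spaces with a continuous, dense and compact embedding $D\hookrightarrow X$, let $1<p<\infty$, and let $I=(a,b)$ be a bounded open interval. For an open interval $J$ bounded from below, $\mathrm{MR}^p(J)=L^p(J;D)\cap W^{1,p}(J;X)$ has the norm $$\|u\|_{\mathrm{MR}^p(J)}=\big(\|u\|^p_{L^p(J;X)}+\|u\|^p_{L^p(J;D)}+w_J^p\,\|u'\|^p_{L^p(J;X)}\big)^{1/p},$$ with $w_J=|J|$ if $J$ is bounded and $w_J=1$ otherwise. $L^\infty(J;\mathcal L(D,X))$ is the space of families $A$ such that, for each $x\in D$, the map $A(\cdot)x$ is Bochner measurable and essentially bounded in $X$. A family $A\in L^\infty(J;\mathcal L(D,X))$ belongs to $\mathcal{MR}_p(J)$ if the graph norm of $A(t)$ is equivalent to $\|\cdot\|_D$ for every $t\in J$, and if for every $f\in L^p(J;X)$ the problem $v'+A(t)v=f$ on $J$, $v(\inf J)=0$, has a unique solution $v\in \mathrm{MR}^p(J)$, with $\|v\|_{\mathrm{MR}^p(J)}\le K\|f\|_{L^p(J;X)}$ for some $K$ independent of $f$. The infimum of such $K$ is denoted $[A]_{\mathcal{MR}_p(J)}$.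 For an operator $A\in\mathcal L(D,X)$, viewed as a constant family, we write $A\in mr_p(J)$ and $[A]_{mr_p(J)}$. A family $A:\overline I\to\mathcal L(D,X)$ such that $A(\cdot)x$ is Bochner measurable for each $x\in D$ is *relatively continuous* if for every $\epsilon>0$ there are $\delta>0$, $\eta\ge0$ with $$\|A(t)x-A(s)x\|_X\le\epsilon\|x\|_D+\eta\|x\|_X\quad\text{for all }x\in D,\ t,s\in\overline I,\ |t-s|\le\delta.$$ A *range of relative continuity* of $A$ is a pair of functions $\delta_A:(0,\infty)\to(0,\infty)$ (nondecreasing) and $\eta_A:(0,\infty)\to[0,\infty)$ (nonincreasing) such that this estimate holds with $\delta=\delta_A(\epsilon)$, $\eta=\eta_A(\epsilon)$ for every $\epsilon>0$. For $A_0:I\to\mathcal L(D,X)$ with $A_0(t)\in mr_p(0,\infty)$ for all $t\in I$, put $$K_0(t)=[A_0(t)]_{mr_p(I)},\qquad M_0(t)=\sup_{\tau\ge0}\|e^{-\tau A_0(t)}\|_{\mathcal L(X)},\qquad \epsilon_0(t)=\frac1{2(K_0(t)+1)(M_0(t)+1)}.$$ **Assumptions.** * **(A1)** $A$ is relatively continuous,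 and there are $A_0:I\to\mathcal L(D,X)$, $B:I\times I\to\mathcal L(D,X)$ and a range of relative continuity $(\delta_A,\eta_A)$ of $A$ such that $A(s)=A_0(t)+B(t,s)$ for all $t,s\in I$, $A_0(t)\in mr_p(0,\infty)$ for all $t\in I$, and for all $x\in D$ and $t,s\in I$ with $|t-s|\le\delta_A(\epsilon_0(t))$, $$\|B(t,s)x\|_X\le\epsilon_0(t)\|x\|_D+\eta_A(\epsilon_0(t))\|x\|_X .$$ * **(A2)** There are $\alpha\ge1$, $\beta\ge0$, $m_\delta\in(0,1]$, $m_\eta\ge0$ such that the range $(\delta_A,\eta_A)$ of (A1) satisfies $\delta_A(\epsilon)=m_\delta\epsilon^\alpha$ and $\eta_A(\epsilon)\le m_\eta\epsilon^{-\beta}$ for all $\epsilon>0$; and there is $r\in(1,\infty)$ such that $(K_0+1)(M_0+1)\in L^{\alpha r}(I)$, i.e. this function is measurable and $$\Gamma:=\Big(\int_I(K_0(t)+1)^{\alpha r}(M_0(t)+1)^{\alpha r}\,dt\Big)^{1/r}<\infty .$$ **Theorem.** There is a constant $C=C(|I|,\|A\|_\infty,p,r,\alpha,\beta)$, where $\|A\|_\infty=\operatorname{ess\,sup}_{t\in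 I}\|A(t)\|_{\mathcal L(D,X)}$, such that whenever (A1) and (A2) hold, $A\in\mathcal{MR}_p(I)$ and $$\log\big([A]_{\mathcal{MR}_p(I)}\big)\le C\left(\Big(\frac{\Gamma}{m_\delta}\Big)^{r^*}\Big\{1+m_\eta\,m_\delta^{s_2}\,\Gamma^{s_1}+\log\Big(\frac{\Gamma}{m_\delta}\Big)\Big\}+m_\eta+1\right),$$ where $r^*=\frac r{r-1}$, $s_1=r^*\big(\frac{\beta+1}\alpha-1\big)$ and $s_2=\frac{\beta+1}{\alpha+1}-\frac{\alpha+1/r}{\alpha+1}\,s_1$. -/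

import Mathlib

open MeasureTheory Set Filter Topology
open scoped ENNReal ContDiff

universe u v

noncomputable section

namespace MaxReg

variable {X : Type u} [NormedAddCommGroup X] [NormedSpace ℝ X]
variable {D : Type v} [NormedAddCommGroup D] [NormedSpace ℝ D]

/-! Throughout, `ι : D →L[ℝ] X` is the embedding of the domain `D` into `X`, and `I` is an open
interval of `ℝ` bounded from below, with left endpoint `sInf I`. Functions and operator families on
`I` are functions on `ℝ` of which only the values on `I` (or on its closure) are used. -/

/-- `w` is a weak derivative of `v` on `I`. -/
def IsWeakDeriv (I : Set ℝ) (v w : ℝ → X) : Prop :=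
  ∀ φ : ℝ → ℝ, ContDiff ℝ ∞ φ → HasCompactSupport φ → tsupport φ ⊆ I →
    -∫ t in I, deriv φ t • v t = ∫ t in I, φ t • w t

/-- `u` belongs to `L^p(I;D) ∩ W^{1,p}(I;X)` and `w ∈ L^p(I;X)` is its weak derivative. -/
structure MemMR (p : ℝ) (ι : D →L[ℝ] X) (I : Set ℝ) (u : ℝ → D) (w : ℝ → X) : Prop where
  memLp : MemLp u (ENNReal.ofReal p) (volume.restrict I)
  memLp_deriv : MemLp w (ENNReal.ofReal p) (volume.restrict I)
  weakDeriv : IsWeakDeriv I (fun t => ι (u t)) w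

/-- The weight in front of the derivative: `|I|` if `I` is bounded and `1` otherwise. -/
def weight (I : Set ℝ) : ℝ≥0∞ :=
  open Classical in if volume I = ⊤ then 1 else volume I

/-- The norm of `L^p(I;D) ∩ W^{1,p}(I;X)` at `u`, where `w` is the weak derivative of `u`. -/
def mrNorm (p : ℝ) (ι : D →L[ℝ] X) (I : Set ℝ) (u : ℝ → D) (w : ℝ → X) : ℝ≥0∞ :=
  (eLpNorm (fun t => ι (u t)) (ENNReal.ofReal p) (volume.restrict I) ^ p
    + eLpNorm u (ENNReal.ofReal p) (volume.restrict I) ^ p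
    + weight I ^ p * eLpNorm w (ENNReal.ofReal p) (volume.restrict I) ^ p) ^ (1 / p)

/-- The representative of `v` that is continuous up to the left endpoint vanishes there. -/
def VanishesAtLeft (I : Set ℝ) (v : ℝ → X) : Prop :=
  ∃ g : ℝ → X, ContinuousOn g (insert (sInf I) I) ∧ g =ᵐ[volume.restrict I] v ∧ g (sInf I) = 0

/-- `u`, with weak derivative `w`, is a solution in the maximal regularity space of
`u' + A(t) u = f` on `I` with zero initial value. -/
structure IsSolution (p : ℝ) (ι : D →L[ℝ] X) (I : Set ℝ) (A : ℝ → D →L[ℝ] X) (f : ℝ → X)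
    (u : ℝ → D) (w : ℝ → X) : Prop where
  memMR : MemMR p ι I u w
  eqn : ∀ᵐ t ∂(volume.restrict I), w t + A t (u t) = f t
  init : VanishesAtLeft I (fun t => ι (u t))

/-- `A ∈ L^∞(I; L(D;X))`: `A` is strongly measurable and `‖A(·)x‖` is essentially bounded for
each `x`. -/
def MemLinfOp (I : Set ℝ) (A : ℝ → D →L[ℝ] X) : Prop :=
  ∀ x : D, MemLp (fun t => A t x) ⊤ (volume.restrict I)

/-- The norm `‖A‖_∞`, the essential supremum over `I` of `‖A(t)‖` in `L(D;X)`. -/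
def opNormInf (I : Set ℝ) (A : ℝ → D →L[ℝ] X) : ℝ :=
  (essSup (fun t => ‖A t‖ₑ) (volume.restrict I)).toReal

/-- The graph norm of `A` is equivalent to the norm of `D`. -/
def GraphNormEquiv (ι A : D →L[ℝ] X) : Prop :=
  ∃ c C : ℝ, 0 < c ∧ 0 < C ∧
    ∀ x : D, c * ‖x‖ ≤ ‖ι x‖ + ‖A x‖ ∧ ‖ι x‖ + ‖A x‖ ≤ C * ‖x‖

/-- `K` is admissible in the maximal regularity inequality of `A` on `I`. -/
def IsMRBound (p : ℝ) (ι : D →L[ℝ] X) (I : Set ℝ) (A : ℝ → D →L[ℝ] X) (K : ℝ≥0∞) : Prop :=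
  ∀ (f : ℝ → X) (u : ℝ → D) (w : ℝ → X),
    MemLp f (ENNReal.ofReal p) (volume.restrict I) → IsSolution p ι I A f u w →
      mrNorm p ι I u w ≤ K * eLpNorm f (ENNReal.ofReal p) (volume.restrict I)

/-- The nonautonomous operator `A` has `L^p` maximal regularity on `I`. -/
structure HasMR (p : ℝ) (ι : D →L[ℝ] X) (I : Set ℝ) (A : ℝ → D →L[ℝ] X) : Prop where
  memLinf : MemLinfOp I A
  graphNorm : ∀ t ∈ I, GraphNormEquiv ι (A t)
  exists_solution : ∀ f : ℝ → X, MemLp f (ENNReal.ofReal p) (volume.restrict I) →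
    ∃ (u : ℝ → D) (w : ℝ → X), IsSolution p ι I A f u w
  unique_solution : ∀ f : ℝ → X, MemLp f (ENNReal.ofReal p) (volume.restrict I) →
    ∀ (u₁ u₂ : ℝ → D) (w₁ w₂ : ℝ → X), IsSolution p ι I A f u₁ w₁ → IsSolution p ι I A f u₂ w₂ →
      u₁ =ᵐ[volume.restrict I] u₂
  exists_bound : ∃ K : ℝ≥0∞, K ≠ ⊤ ∧ IsMRBound p ι I A K

/-- The maximal regularity constant of `A` on `I`. -/
def mrConst (p : ℝ) (ι : D →L[ℝ] X) (I : Set ℝ) (A : ℝ → D →L[ℝ] X) : ℝ≥0∞ :=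
  sInf {K : ℝ≥0∞ | IsMRBound p ι I A K}

/-- Maximal regularity of an autonomous operator, i.e. of the constant family `t ↦ A`. -/
def HasAutMR (p : ℝ) (ι : D →L[ℝ] X) (I : Set ℝ) (A : D →L[ℝ] X) : Prop :=
  HasMR p ι I (fun _ => A)

/-- The maximal regularity constant of an autonomous operator. -/
def autMRConst (p : ℝ) (ι : D →L[ℝ] X) (I : Set ℝ) (A : D →L[ℝ] X) : ℝ≥0∞ :=
  mrConst p ι I (fun _ => A)

/-- `(S τ)_{τ ≥ 0}` is the strongly continuous semigroup `e^{-τ A}`, i.e. its infinitesimal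
generator is exactly `-A` with domain `D`. Values of `S` at negative times play no role. -/
structure IsSemigroupOf (ι A : D →L[ℝ] X) (S : ℝ → X →L[ℝ] X) : Prop where
  zero : S 0 = ContinuousLinearMap.id ℝ X
  add : ∀ s t : ℝ, 0 ≤ s → 0 ≤ t → S (s + t) = (S s).comp (S t)
  cont : ∀ x : X, Tendsto (fun τ => S τ x) (𝓝[>] 0) (𝓝 x)
  generator : ∀ x y : X, Tendsto (fun τ : ℝ => τ⁻¹ • (S τ x - x)) (𝓝[>] 0) (𝓝 y) ↔
    ∃ d : D, ι d = x ∧ y = -(A d)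

/-- `sup_{τ ≥ 0} ‖e^{-τ A}‖`. A semigroup is determined by its generator, so the infimum is over at
most one semigroup; it gives the value `⊤` when `-A` generates none. -/
def semigroupBound (ι A : D →L[ℝ] X) : ℝ≥0∞ :=
  ⨅ (S : ℝ → X →L[ℝ] X) (_ : IsSemigroupOf ι A S), ⨆ (τ : ℝ) (_ : 0 ≤ τ), ‖S τ‖ₑ

/-- The estimate `P^ε_{η,δ}` on the closed interval `[a,b]`. -/
def RelContEst (ι : D →L[ℝ] X) (a b : ℝ) (A : ℝ → D →L[ℝ] X) (ε δ η : ℝ) : Prop :=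
  ∀ x : D, ∀ t ∈ Icc a b, ∀ s ∈ Icc a b, |t - s| ≤ δ →
    ‖A t x - A s x‖ ≤ ε * ‖x‖ + η * ‖ι x‖

/-- `A` is relatively continuous on `(a,b)`. -/
structure RelCont (ι : D →L[ℝ] X) (a b : ℝ) (A : ℝ → D →L[ℝ] X) : Prop where
  stronglyMeasurable : ∀ x : D, AEStronglyMeasurable (fun t => A t x) (volume.restrict (Ioo a b))
  est : ∀ ε : ℝ, 0 < ε → ∃ δ η : ℝ, 0 < δ ∧ 0 ≤ η ∧ RelContEst ι a b A ε δ η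

/-- `(δ, η)` is a specific range of relative continuity of `A`. -/
structure IsRange (ι : D →L[ℝ] X) (a b : ℝ) (A : ℝ → D →L[ℝ] X) (δ η : ℝ → ℝ) : Prop where
  pos : ∀ ε : ℝ, 0 < ε → 0 < δ ε
  nonneg : ∀ ε : ℝ, 0 < ε → 0 ≤ η ε
  est : ∀ ε : ℝ, 0 < ε → RelContEst ι a b A ε (δ ε) (η ε)
  mono : MonotoneOn δ (Ioi 0)
  anti : AntitoneOn η (Ioi 0)

/-- `K₀(t)`, the maximal regularity constant of `A₀(t)` on `(a,b)`. -/
def K₀ (p : ℝ) (ι : D →L[ℝ] X) (a b : ℝ) (A₀ : ℝ → D →L[ℝ] X) (t : ℝ) : ℝ≥0∞ :=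
  autMRConst p ι (Ioo a b) (A₀ t)

/-- `M₀(t) = sup_{τ ≥ 0} ‖e^{-τ A₀(t)}‖`. -/
def M₀ (ι : D →L[ℝ] X) (A₀ : ℝ → D →L[ℝ] X) (t : ℝ) : ℝ≥0∞ :=
  semigroupBound ι (A₀ t)

/-- `ε₀(t) = 1 / (2 (K₀(t) + 1) (M₀(t) + 1))`. -/
def ε₀ (p : ℝ) (ι : D →L[ℝ] X) (a b : ℝ) (A₀ : ℝ → D →L[ℝ] X) (t : ℝ) : ℝ :=
  (1 / (2 * (K₀ p ι a b A₀ t + 1) * (M₀ ι A₀ t + 1))).toReal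

/-- Relative continuity of `A` on `(a,b)` together with the decomposition `A(s) = A₀(t) + B(t,s)`,
where `(δ, η)` is the range of relative continuity that controls the perturbation `B`. -/
structure AssumptionA1 (p : ℝ) (ι : D →L[ℝ] X) (a b : ℝ) (A A₀ : ℝ → D →L[ℝ] X)
    (B : ℝ → ℝ → D →L[ℝ] X) (δ η : ℝ → ℝ) : Prop where
  relCont : RelCont ι a b A
  decomp : ∀ t ∈ Ioo a b, ∀ s ∈ Ioo a b, A s = A₀ t + B t s
  pointwiseMR : ∀ t ∈ Ioo a b, HasAutMR p ι (Ioi 0) (A₀ t)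
  range : IsRange ι a b A δ η
  perturbation : ∀ x : D, ∀ t ∈ Ioo a b, ∀ s ∈ Ioo a b, |t - s| ≤ δ (ε₀ p ι a b A₀ t) →
    ‖B t s x‖ ≤ ε₀ p ι a b A₀ t * ‖x‖ + η (ε₀ p ι a b A₀ t) * ‖ι x‖

/-- `Γ = (∫_I (K₀ + 1)^{αr} (M₀ + 1)^{αr} dt)^{1/r}`, possibly infinite. -/
def Γ (p r α : ℝ) (ι : D →L[ℝ] X) (a b : ℝ) (A₀ : ℝ → D →L[ℝ] X) : ℝ≥0∞ :=
  (∫⁻ t in Ioo a b, (K₀ p ι a b A₀ t + 1) ^ (α * r) * (M₀ ι A₀ t + 1) ^ (α * r)) ^ (1 / r)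

/-- Hölder-type form of the range `(δ, η)` and integrability of `((K₀ + 1)(M₀ + 1))^{αr}`. -/
structure AssumptionA2 (p r α β mδ mη : ℝ) (ι : D →L[ℝ] X) (a b : ℝ) (A₀ : ℝ → D →L[ℝ] X)
    (δ η : ℝ → ℝ) : Prop where
  mδ_pos : 0 < mδ
  mδ_le_one : mδ ≤ 1
  mη_nonneg : 0 ≤ mη
  δ_eq : ∀ ε : ℝ, 0 < ε → δ ε = mδ * ε ^ α
  η_le : ∀ ε : ℝ, 0 < ε → η ε ≤ mη * ε ^ (-β)
  measurable : AEMeasurable (fun t => (K₀ p ι a b A₀ t + 1) * (M₀ ι A₀ t + 1))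
    (volume.restrict (Ioo a b))
  integrable : Γ p r α ι a b A₀ < ⊤

/-- The conjugate exponent `r^* = r / (r - 1)`. -/
def rStar (r : ℝ) : ℝ := r / (r - 1)

/-- `s₁ = r^* ((β + 1) / α - 1)`. -/
def s₁ (α β r : ℝ) : ℝ := rStar r * ((β + 1) / α - 1)

/-- `s₂ = (β + 1) / (α + 1) - ((α + 1 / r) / (α + 1)) s₁`. -/
def s₂ (α β r : ℝ) : ℝ := (β + 1) / (α + 1) - (α + 1 / r) / (α + 1) * s₁ α β r

end MaxReg

end

noncomputable section

namespace MaxReg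

variable {X : Type u} [NormedAddCommGroup X] [NormedSpace ℝ X]
variable {D : Type v} [NormedAddCommGroup D] [NormedSpace ℝ D]

section Calculus

/-! ### Absolutely continuous functions with values in a Banach space -/

/-! The operator is frozen on short cells, treated there as a perturbation of an autonomous
operator, and the cells are glued.

Write h = (K₀+1)(M₀+1), so ε₀ = 1/(2h). If a cell is no longer than δ_A(ε₀(t)) for some t in it,
then A = A₀(t) + B on the cell with ‖Bx‖ ≤ ε₀‖x‖_D + η‖x‖_X. The part with ε₀ is absorbed by maximal
regularity of A₀(t), the part with η by a spectral shift. For u' + (A₀ + l)u = g with zero initial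
value one has l‖u‖_{L^p(X)} ≤ M‖g‖_{L^p(X)} (`IsMildSol.resolvent_estimate`), hence ‖u‖_{L^p(D)} ≤
K₀(1+M)‖g‖_{L^p(X)} uniformly in l. With l = 4ηM + 1 the perturbation has norm at most 1/2 + 1/4 in
the space of data, and a contraction argument solves the problem (`wellPosed_of_perturbation`).
Undoing the shift costs exp(l·length).

The function h need not be bounded, so the freezing point is selected by Chebyshev's inequality: a
cell of length ℓ contains a t with (2h(t))^α < m_δ/ℓ once ℓ⁻¹ > (2^α Γ/m_δ)^{r*}
(`exists_good_point`). Thus N of order (Γ/m_δ)^{r*} equal cells suffice, and 2h ≤ z := (m_δ/ℓ)^{1/α}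
at all chosen points.

Adjacent cells are joined by subtracting the reflection of the earlier piece, which restores a zero
initial value and needs no trace space (`WellPosed.glue`). The constants multiply. The logarithm of
the product is therefore N(log z + const) plus |I|(4 m_η z^{β+1} + 1), the exponents adding up to
|I| because Nℓ = |I|. Elementary estimates (`exists_const_log_bound`) turn this into the stated
bound.

All of this is done for the integrated form `IsMildSol`, in which ιu is the primitive of its
derivative; a du Bois-Reymond argument shows its equivalence with the weak formulation. -/

lemma absolutelyContinuousOnInterval_of_dist_le {E E' : Type*} [PseudoMetricSpace E]
    [PseudoMetricSpace E'] {f : ℝ → E} {g : ℝ → E'} {a b C : ℝ} (hg : AbsolutelyContinuousOnInterval g a b)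
    (h : ∀ x ∈ uIcc a b, ∀ y ∈ uIcc a b, dist (f x) (f y) ≤ C * dist (g x) (g y)) :
    AbsolutelyContinuousOnInterval f a b := by
  unfold AbsolutelyContinuousOnInterval at hg ⊢
  refine squeeze_zero' ?_ ?_ (by simpa using hg.const_mul C)
  · exact Eventually.of_forall fun _ => Finset.sum_nonneg fun i _ => dist_nonneg
  · rw [eventually_inf_principal]
    filter_upwards with E hE
    rw [Finset.mul_sum]
    exact Finset.sum_le_sum fun i hi => h _ (hE.1 i hi).1 _ (hE.1 i hi).2

lemma dist_integral_le {w : ℝ → X} {a b : ℝ} (hw : IntervalIntegrable w volume a b)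
    {x y : ℝ} (hx : x ∈ uIcc a b) (hy : y ∈ uIcc a b) :
    dist (∫ s in a..x, w s) (∫ s in a..y, w s)
      ≤ 1 * dist (∫ s in a..x, ‖w s‖) (∫ s in a..y, ‖w s‖) := by
  have h : ∀ z ∈ uIcc a b, IntervalIntegrable w volume a z := fun z hz =>
    hw.mono_set (uIcc_subset_uIcc left_mem_uIcc hz)
  rw [dist_eq_norm, dist_eq_norm, intervalIntegral.integral_interval_sub_left (h x hx) (h y hy),
    intervalIntegral.integral_interval_sub_left (h x hx).norm (h y hy).norm, one_mul]
  exact intervalIntegral.norm_integral_le_abs_integral_norm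

/-- Increments of the primitive are dominated by those of the scalar primitive of ‖w‖. -/
lemma absolutelyContinuousOnInterval_integral {w : ℝ → X} {a b : ℝ}
    (hw : IntervalIntegrable w volume a b) :
    AbsolutelyContinuousOnInterval (fun x => ∫ s in a..x, w s) a b :=
  absolutelyContinuousOnInterval_of_dist_le
    (hw.norm.absolutelyContinuousOnInterval_intervalIntegral left_mem_uIcc)
    fun _ hx _ hy => dist_integral_le hw hx hy

lemma continuousOn_integral {w : ℝ → X} {a b : ℝ} (hw : IntervalIntegrable w volume a b) :
    ContinuousOn (fun x => ∫ s in a..x, w s) (uIcc a b) :=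
  (absolutelyContinuousOnInterval_integral hw).continuousOn

lemma setIntegral_smul_eq_integral {S : Set ℝ} {φ : ℝ → ℝ} (hφ : tsupport φ ⊆ S) (v : ℝ → X) :
    ∫ t in S, φ t • v t = ∫ t, φ t • v t :=
  setIntegral_eq_integral_of_forall_compl_eq_zero fun t ht => by
    rw [image_eq_zero_of_notMem_tsupport fun h => ht (hφ h), zero_smul]

/-- A test function supported in S is also one for T, and the integrals only see its support. -/
lemma IsWeakDeriv.mono {S T : Set ℝ} (hST : S ⊆ T) {v w : ℝ → X} (h : IsWeakDeriv T v w) :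
    IsWeakDeriv S v w := by
  intro φ hφ hc hs
  have := h φ hφ hc (hs.trans hST)
  have hd : tsupport (deriv φ) ⊆ S := tsupport_deriv_subset.trans hs
  rwa [setIntegral_smul_eq_integral (hd.trans hST), setIntegral_smul_eq_integral (hs.trans hST),
    ← setIntegral_smul_eq_integral hd, ← setIntegral_smul_eq_integral hs] at this

variable [CompleteSpace X]

/-- A general Banach space lacks the Radon-Nikodym property, so differentiability almost everywhere
must be assumed. Subtracting the primitive of w leaves an absolutely continuous function with zero
derivative, which is constant. -/
lemma sub_eq_integral_of_ae_hasDerivAt {f w : ℝ → X} {a b : ℝ}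
    (hf : AbsolutelyContinuousOnInterval f a b) (hw : IntervalIntegrable w volume a b)
    (h : ∀ᵐ x, x ∈ uIcc a b → HasDerivAt f (w x) x) {x : ℝ} (hx : x ∈ uIcc a b) :
    f x - f a = ∫ t in a..x, w t := by
  have hac : AbsolutelyContinuousOnInterval (fun x => f x - ∫ t in a..x, w t) a b :=
    hf.sub (absolutelyContinuousOnInterval_integral hw)
  obtain ⟨C, hC⟩ := hac.const_of_ae_hasDerivAt_zero (by
    filter_upwards [h, hw.ae_hasDerivAt_integral] with x hx₁ hx₂ hx₃
    have := (hx₁ hx₃).sub (hx₂ hx₃ a left_mem_uIcc)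
    rwa [sub_self] at this)
  have h1 := hC x hx
  have h2 := hC a left_mem_uIcc
  simp only [intervalIntegral.integral_same, sub_zero] at h2
  rw [h2, ← h1]; abel

/-- Integration by parts: the product is absolutely continuous, and the product rule holds almost
everywhere. -/
lemma smul_integral_eq_integral {w : ℝ → X} {a b : ℝ} (hw : IntervalIntegrable w volume a b)
    {φ : ℝ → ℝ} (hφ : ContDiff ℝ 1 φ) {x : ℝ} (hx : x ∈ uIcc a b) :
    φ x • ∫ s in a..x, w s
      = ∫ s in a..x, (φ s • w s + deriv φ s • ∫ r in a..s, w r) := by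
  have hφ' : Continuous (deriv φ) := hφ.continuous_deriv le_rfl
  have hac : AbsolutelyContinuousOnInterval (fun x => φ x • ∫ s in a..x, w s) a b :=
    (hφ.contDiffOn.absolutelyContinuousOnInterval).smul
      (absolutelyContinuousOnInterval_integral hw)
  have hint : IntervalIntegrable (fun s => φ s • w s + deriv φ s • ∫ r in a..s, w r)
      volume a b := by
    refine (hw.continuousOn_smul hφ.continuous.continuousOn).add ?_
    exact (hφ'.continuousOn.smul (continuousOn_integral hw)).intervalIntegrable
  have := sub_eq_integral_of_ae_hasDerivAt hac hint (by
    filter_upwards [hw.ae_hasDerivAt_integral] with x hx₂ hx₃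
    exact (hφ.differentiable one_ne_zero x).hasDerivAt.smul (hx₂ hx₃ a left_mem_uIcc)) hx
  simpa using this

/-! ### Weak derivatives and primitives -/

lemma isWeakDeriv_integral {w : ℝ → X} {c d : ℝ} (hcd : c < d)
    (hw : IntervalIntegrable w volume c d) :
    IsWeakDeriv (Ioo c d) (fun t => ∫ s in c..t, w s) w := by
  intro φ hφ _ hsupp
  have hφ1 : ContDiff ℝ 1 φ := hφ.of_le (by exact_mod_cast le_top)
  have h := smul_integral_eq_integral hw hφ1 (right_mem_uIcc (a := c) (b := d))
  have hφd : φ d = 0 := image_eq_zero_of_notMem_tsupport fun h => (hsupp h).2.false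
  have h1 : IntervalIntegrable (fun s => φ s • w s) volume c d :=
    hw.continuousOn_smul hφ.continuous.continuousOn
  have h2 : IntervalIntegrable (fun s => deriv φ s • ∫ r in c..s, w r) volume c d :=
    ((hφ1.continuous_deriv le_rfl).continuousOn.smul
      (continuousOn_integral hw)).intervalIntegrable
  rw [intervalIntegral.integral_add h1 h2, hφd, zero_smul] at h
  rw [← integral_Ioc_eq_integral_Ioo, ← integral_Ioc_eq_integral_Ioo,
    ← intervalIntegral.integral_of_le hcd.le, ← intervalIntegral.integral_of_le hcd.le]
  exact (eq_neg_of_add_eq_zero_left h.symm).symm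

lemma exists_contDiff_integral_eq_one {c d : ℝ} (hcd : c < d) :
    ∃ χ : ℝ → ℝ, ContDiff ℝ ∞ χ ∧ HasCompactSupport χ ∧ tsupport χ ⊆ Ioo c d ∧
      ∫ t, χ t = 1 := by
  let B : ContDiffBump ((c + d) / 2) := ⟨(d - c) / 8, (d - c) / 4, by linarith, by linarith⟩
  refine ⟨B.normed volume, B.contDiff_normed, B.hasCompactSupport_normed, ?_, B.integral_normed⟩
  rw [B.tsupport_normed_eq]
  intro x hx
  rw [Metric.mem_closedBall, Real.dist_eq, abs_le] at hx
  change -((d - c) / 4) ≤ _ ∧ _ ≤ (d - c) / 4 at hx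
  constructor <;> linarith [hx.1, hx.2]

/-- The primitive of ψ from c vanishes to the left of the support of ψ, and to its right because ψ
has mean zero. Hence it is again a test function. -/
lemma exists_contDiff_deriv_eq {c d : ℝ} {ψ : ℝ → ℝ} (hψ : ContDiff ℝ ∞ ψ)
    (hc : HasCompactSupport ψ) (hs : tsupport ψ ⊆ Ioo c d) (h0 : ∫ t, ψ t = 0) :
    ∃ φ : ℝ → ℝ, ContDiff ℝ ∞ φ ∧ HasCompactSupport φ ∧ tsupport φ ⊆ Ioo c d ∧
      deriv φ = ψ := by
  have hi : Integrable ψ := hψ.continuous.integrable_of_hasCompactSupport hc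
  have hder : ∀ x, HasDerivAt (fun x => ∫ t in c..x, ψ t) (ψ x) x := fun x =>
    intervalIntegral.integral_hasDerivAt_right hi.intervalIntegrable
      (hψ.continuous.stronglyMeasurableAtFilter _ _) hψ.continuous.continuousAt
  have hderiv : deriv (fun x => ∫ t in c..x, ψ t) = ψ := funext fun x => (hder x).deriv
  -- Compactness leaves a margin at both ends of the interval; for empty support any bounds with
  -- this margin serve.
  have hsub : ∃ c' d', c < c' ∧ d' < d ∧ tsupport ψ ⊆ Icc c' d' := by
    rcases (tsupport ψ).eq_empty_or_nonempty with he | hne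
    · exact ⟨c + 1, d - 1, by linarith, by linarith, by simp [he]⟩
    · have hcpt : IsCompact (tsupport ψ) := hc
      exact ⟨sInf (tsupport ψ), sSup (tsupport ψ), (hs (hcpt.sInf_mem hne)).1,
        (hs (hcpt.sSup_mem hne)).2, fun x hx =>
          ⟨csInf_le hcpt.bddBelow hx, le_csSup hcpt.bddAbove hx⟩⟩
  obtain ⟨c', d', hc', hd', hsub⟩ := hsub
  have hz : ∀ x, x ∉ Icc c' d' → ψ x = 0 := fun x hx =>
    image_eq_zero_of_notMem_tsupport fun h => hx (hsub h)
  have hsupp : Function.support (fun x => ∫ t in c..x, ψ t) ⊆ Icc c' d' := by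
    intro x hx
    by_contra hxn
    apply hx
    simp only [mem_Icc, not_and_or, not_le] at hxn
    rcases hxn with h | h
    · refine intervalIntegral.integral_zero_ae ?_
      filter_upwards with t ht
      refine hz t fun hmem => ?_
      have := (uIoc_subset_uIcc ht).2
      have h3 : max c x < c' := max_lt hc' h
      exact absurd (hmem.1.trans this) (not_le.2 h3)
    · have e1 : ∫ t in Iic x, ψ t = 0 := by
        rw [← h0]
        refine setIntegral_eq_integral_of_forall_compl_eq_zero fun t ht => hz t fun hm => ?_
        exact ht (hm.2.trans h.le)
      have e2 : ∫ t in Iic c, ψ t = 0 :=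
        setIntegral_eq_zero_of_forall_eq_zero fun t ht => hz t fun hm => by
          have : t ≤ c := ht
          linarith [hm.1]
      simp only
      rw [← intervalIntegral.integral_Iic_sub_Iic hi.integrableOn hi.integrableOn, e1, e2, sub_zero]
  have hts : tsupport (fun x => ∫ t in c..x, ψ t) ⊆ Icc c' d' :=
    closure_minimal hsupp isClosed_Icc
  refine ⟨fun x => ∫ t in c..x, ψ t, ?_, ?_, fun x hx => ?_, hderiv⟩
  · rw [contDiff_infty_iff_deriv, hderiv]
    exact ⟨fun x => (hder x).differentiableAt, hψ⟩
  · exact isCompact_Icc.of_isClosed_subset (isClosed_tsupport _) hts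
  · exact ⟨hc'.trans_le (hts hx).1, (hts hx).2.trans_lt hd'⟩

/-- Du Bois-Reymond: v minus the primitive of w has weak derivative zero. Every test function ψ is
(∫ψ)χ plus a derivative of a test function, with χ fixed of integral one, so this difference acts on
ψ like a constant k. -/
lemma IsWeakDeriv.exists_ae_eq_add_integral {v w : ℝ → X} {c d : ℝ} (hcd : c < d)
    (hv : IntegrableOn v (Ioo c d)) (hw : IntegrableOn w (Ioo c d))
    (h : IsWeakDeriv (Ioo c d) v w) :
    ∃ k : X, ∀ᵐ t ∂(volume.restrict (Ioo c d)), v t = k + ∫ s in c..t, w s := by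
  have hwi : IntervalIntegrable w volume c d :=
    (intervalIntegrable_iff_integrableOn_Ioo_of_le hcd.le).2 hw
  set z : ℝ → X := fun t => v t - ∫ s in c..t, w s with hz
  have hci : IntegrableOn (fun t => ∫ s in c..t, w s) (Ioo c d) :=
    (intervalIntegrable_iff_integrableOn_Ioo_of_le hcd.le).1
      (continuousOn_integral hwi).intervalIntegrable
  have hzi : IntegrableOn z (Ioo c d) := hv.sub hci
  have hsm : ∀ {g : ℝ → X} {φ : ℝ → ℝ}, IntegrableOn g (Ioo c d) → Continuous φ →
      HasCompactSupport φ → IntegrableOn (fun t => φ t • g t) (Ioo c d) := by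
    intro g φ hg hφ hc
    obtain ⟨C, hC⟩ := hφ.bounded_above_of_compact_support hc
    exact Integrable.bdd_smul hg C hφ.aestronglyMeasurable (Eventually.of_forall hC)
  have hz0 : ∀ φ : ℝ → ℝ, ContDiff ℝ ∞ φ → HasCompactSupport φ → tsupport φ ⊆ Ioo c d →
      ∫ t in Ioo c d, deriv φ t • z t = 0 := by
    intro φ hφ hc hs
    have h1 := h φ hφ hc hs
    have h2 := isWeakDeriv_integral hcd hwi φ hφ hc hs
    have hφ' : Continuous (deriv φ) := hφ.continuous_deriv (by simp)
    simp only [hz, smul_sub]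
    rw [integral_sub (hsm hv hφ' hc.deriv) (hsm hci hφ' hc.deriv), sub_eq_zero]
    exact neg_injective (h1.trans h2.symm)
  obtain ⟨χ, hχ, hχc, hχs, hχ1⟩ := exists_contDiff_integral_eq_one hcd
  set k : X := ∫ t in Ioo c d, χ t • z t with hk
  refine ⟨k, ?_⟩
  have hfund := isOpen_Ioo.ae_eq_zero_of_integral_contDiff_smul_eq_zero (U := Ioo c d)
    (f := fun t => z t - k) (μ := volume) ((hzi.sub (integrableOn_const (by simp))).locallyIntegrableOn)
    (by
      intro ψ hψ hψc hψs
      rw [← setIntegral_smul_eq_integral hψs]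
      set m : ℝ := ∫ t, ψ t with hm
      have hρ : ContDiff ℝ ∞ (fun t => ψ t - m * χ t) := hψ.sub (contDiff_const.mul hχ)
      have hρs : tsupport (fun t => ψ t - m * χ t) ⊆ Ioo c d := by
        refine (tsupport_sub _ _).trans (union_subset hψs ?_)
        exact (tsupport_mul_subset_right).trans hχs
      have hρc : HasCompactSupport (fun t => ψ t - m * χ t) := hψc.sub (hχc.mul_left)
      have hψi : Integrable ψ := hψ.continuous.integrable_of_hasCompactSupport hψc
      have hχi : Integrable χ := hχ.continuous.integrable_of_hasCompactSupport hχc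
      obtain ⟨φ, hφ, hφc, hφs, hφd⟩ := exists_contDiff_deriv_eq hρ hρc hρs (by
        rw [integral_sub hψi (hχi.const_mul m), integral_const_mul, hχ1, mul_one, hm, sub_self])
      have h0 := hz0 φ hφ hφc hφs
      rw [hφd] at h0
      simp only [sub_smul, mul_smul] at h0
      rw [integral_sub (hsm hzi hψ.continuous hψc) ((hsm hzi hχ.continuous hχc).fun_smul m),
        integral_smul, ← hk, sub_eq_zero] at h0
      have hki : IntegrableOn (fun _ : ℝ => k) (Ioo c d) := integrableOn_const (by simp)
      simp only [smul_sub]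
      rw [integral_sub (hsm hzi hψ.continuous hψc) (hsm hki hψ.continuous hψc), h0,
        setIntegral_smul_eq_integral hψs, integral_smul_const, sub_self])
  rw [ae_restrict_iff' measurableSet_Ioo]
  filter_upwards [hfund] with t ht htI
  have := ht htI
  simp only [hz] at this
  rw [sub_sub, sub_eq_zero] at this
  rw [this, add_comm]

end Calculus

/-! ### Solutions in integrated form -/

section Integrated

/-- `u`, with derivative `w`, solves `u' + A(t) u = f` on `(c,d)` with zero initial value, where
`ι ∘ u` is the primitive of `w` vanishing at `c`. -/
structure IsMildSol (p : ℝ) (ι : D →L[ℝ] X) (c d : ℝ) (A : ℝ → D →L[ℝ] X) (f : ℝ → X)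
    (u : ℝ → D) (w : ℝ → X) : Prop where
  memLp : MemLp u (ENNReal.ofReal p) (volume.restrict (Ioo c d))
  memLp_deriv : MemLp w (ENNReal.ofReal p) (volume.restrict (Ioo c d))
  eqn : ∀ᵐ t ∂(volume.restrict (Ioo c d)), w t + A t (u t) = f t
  integral : ∀ᵐ t ∂(volume.restrict (Ioo c d)), ι (u t) = ∫ s in c..t, w s

variable {p : ℝ} {ι : D →L[ℝ] X} {A A' : ℝ → D →L[ℝ] X} {f f' g : ℝ → X} {u u' : ℝ → D}
  {w w' : ℝ → X} {c d : ℝ}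

lemma integrableOn_of_memLp {E : Type*} [NormedAddCommGroup E] {w : ℝ → E} {p c d : ℝ}
    (hp : 1 ≤ p)
    (hw : MemLp w (ENNReal.ofReal p) (volume.restrict (Ioo c d))) : IntegrableOn w (Ioo c d) :=
  hw.integrable (ENNReal.one_le_ofReal.2 hp)

lemma intervalIntegrable_of_memLp {E : Type*} [NormedAddCommGroup E] {w : ℝ → E} {p c d : ℝ}
    (hp : 1 ≤ p) (hcd : c ≤ d)
    (hw : MemLp w (ENNReal.ofReal p) (volume.restrict (Ioo c d))) :
    IntervalIntegrable w volume c d :=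
  (intervalIntegrable_iff_integrableOn_Ioo_of_le hcd).2 (integrableOn_of_memLp hp hw)

lemma memLp_continuous_smul {E : Type*} [NormedAddCommGroup E] [NormedSpace ℝ E] {q : ℝ≥0∞}
    {φ : ℝ → ℝ} (hφ : Continuous φ) {v : ℝ → E} (hv : MemLp v q (volume.restrict (Ioo c d))) :
    MemLp (fun t => φ t • v t) q (volume.restrict (Ioo c d)) := by
  obtain ⟨C, hC⟩ := (isCompact_Icc (a := c) (b := d)).exists_bound_of_continuousOn hφ.continuousOn
  refine hv.of_le_mul (c := C) (hφ.aestronglyMeasurable.smul hv.1) ?_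
  filter_upwards [ae_restrict_mem measurableSet_Ioo] with t ht
  rw [norm_smul]
  exact mul_le_mul_of_nonneg_right (hC t (Ioo_subset_Icc_self ht)) (norm_nonneg _)

lemma memLp_clm {q : ℝ≥0∞} {μ : Measure ℝ} (ι : D →L[ℝ] X) {u : ℝ → D} (hu : MemLp u q μ) :
    MemLp (fun t => ι (u t)) q μ :=
  ι.comp_memLp' hu

lemma IsMildSol.congr (h : IsMildSol p ι c d A f u w)
    (h' : ∀ᵐ t ∂(volume.restrict (Ioo c d)), w t + A' t (u t) = f' t) :
    IsMildSol p ι c d A' f' u w :=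
  ⟨h.memLp, h.memLp_deriv, h', h.integral⟩

lemma IsMildSol.sub (hp : 1 ≤ p) (h : IsMildSol p ι c d A f u w)
    (h' : IsMildSol p ι c d A f' u' w') :
    IsMildSol p ι c d A (fun t => f t - f' t) (fun t => u t - u' t) (fun t => w t - w' t) := by
  refine ⟨h.memLp.sub h'.memLp, h.memLp_deriv.sub h'.memLp_deriv, ?_, ?_⟩
  · filter_upwards [h.eqn, h'.eqn] with t h1 h2
    rw [map_sub, ← h1, ← h2]; abel
  · filter_upwards [h.integral, h'.integral, ae_restrict_mem measurableSet_Ioo] with t h1 h2 ht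
    have hcd : c ≤ d := (ht.1.trans ht.2).le
    have hs : uIcc c t ⊆ uIcc c d := by
      rw [uIcc_of_le hcd, uIcc_of_le ht.1.le]; exact Icc_subset_Icc_right ht.2.le
    rw [map_sub, h1, h2, intervalIntegral.integral_sub
      ((intervalIntegrable_of_memLp hp hcd h.memLp_deriv).mono_set hs)
      ((intervalIntegrable_of_memLp hp hcd h'.memLp_deriv).mono_set hs)]

lemma IsMildSol.mono {d' : ℝ} (h : IsMildSol p ι c d A f u w) (hd : d' ≤ d) :
    IsMildSol p ι c d' A f u w :=
  have hm : volume.restrict (Ioo c d') ≤ volume.restrict (Ioo c d) :=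
    Measure.restrict_mono (Ioo_subset_Ioo_right hd) le_rfl
  ⟨h.memLp.mono_measure hm, h.memLp_deriv.mono_measure hm, ae_mono hm h.eqn,
    ae_mono hm h.integral⟩

lemma measurePreserving_add_Ioo (c d τ : ℝ) :
    MeasurePreserving (fun t => t + τ) (volume.restrict (Ioo (c - τ) (d - τ)))
      (volume.restrict (Ioo c d)) := by
  have := (measurePreserving_add_right (volume : Measure ℝ) τ).restrict_preimage
    (measurableSet_Ioo (a := c) (b := d))
  simpa using this

lemma IsMildSol.comp_add (h : IsMildSol p ι c d A f u w) (τ : ℝ) :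
    IsMildSol p ι (c - τ) (d - τ) (fun t => A (t + τ)) (fun t => f (t + τ))
      (fun t => u (t + τ)) (fun t => w (t + τ)) := by
  have hm := measurePreserving_add_Ioo c d τ
  refine ⟨h.memLp.comp_measurePreserving hm, h.memLp_deriv.comp_measurePreserving hm,
    hm.quasiMeasurePreserving.ae h.eqn, ?_⟩
  filter_upwards [hm.quasiMeasurePreserving.ae h.integral] with t ht
  rw [ht, intervalIntegral.integral_comp_add_right (fun s => w s), sub_add_cancel]

variable [CompleteSpace X]

/-- The product rule adds φ' ιu to the data, and the zero initial value is kept. -/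
lemma IsMildSol.smul (hp : 1 ≤ p) (h : IsMildSol p ι c d A f u w) {φ : ℝ → ℝ}
    (hφ : ContDiff ℝ 1 φ) :
    IsMildSol p ι c d A (fun t => φ t • f t + deriv φ t • ι (u t)) (fun t => φ t • u t)
      (fun t => φ t • w t + deriv φ t • ι (u t)) := by
  have hφ' := hφ.continuous_deriv le_rfl
  refine ⟨memLp_continuous_smul hφ.continuous h.memLp,
    (memLp_continuous_smul hφ.continuous h.memLp_deriv).add
      (memLp_continuous_smul hφ' (memLp_clm ι h.memLp)), ?_, ?_⟩
  · filter_upwards [h.eqn] with t ht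
    rw [map_smul, ← ht, smul_add]; abel
  · have h2 := (ae_restrict_iff' measurableSet_Ioo).1 h.integral
    filter_upwards [h.integral, ae_restrict_mem measurableSet_Ioo] with t h1 ht
    have hcd : c ≤ d := (ht.1.trans ht.2).le
    rw [map_smul, h1, smul_integral_eq_integral (intervalIntegrable_of_memLp hp hcd h.memLp_deriv)
      hφ (by rw [uIcc_of_le hcd]; exact Ioo_subset_Icc_self ht)]
    refine intervalIntegral.integral_congr_ae ?_
    have hne : ∀ᵐ s : ℝ, s ≠ c := by simp [ae_iff, measure_singleton]
    filter_upwards [h2, hne] with s hs _ hsI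
    rw [uIoc_of_le ht.1.le] at hsI
    rw [hs ⟨hsI.1, hsI.2.trans_lt ht.2⟩]

/-- The exponential weight trades a spectral shift by l for a change of data; its derivative
produces exactly the term with l. -/
lemma IsMildSol.exp_smul (hp : 1 ≤ p) (h : IsMildSol p ι c d A f u w) (l : ℝ) :
    IsMildSol p ι c d (fun t => A t + l • ι) (fun t => Real.exp (-l * (t - c)) • f t)
      (fun t => Real.exp (-l * (t - c)) • u t)
      (fun t => Real.exp (-l * (t - c)) • w t - (l * Real.exp (-l * (t - c))) • ι (u t)) := by
  have hφ : ContDiff ℝ 1 (fun t : ℝ => Real.exp (-l * (t - c))) := by fun_prop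
  have hd : ∀ t, deriv (fun t : ℝ => Real.exp (-l * (t - c))) t
      = -(l * Real.exp (-l * (t - c))) := fun t => by
    have h1 : HasDerivAt (fun t : ℝ => -l * (t - c)) (-l * 1) t :=
      ((hasDerivAt_id t).sub_const c).const_mul (-l)
    rw [h1.exp.deriv]; ring
  have h1 := h.smul hp hφ
  simp only [hd, neg_smul, ← sub_eq_add_neg] at h1
  refine h1.congr ?_
  filter_upwards [h1.eqn] with t ht
  simp only [add_apply, smul_apply, map_smul] at ht ⊢
  rw [eq_sub_iff_add_eq] at ht
  rw [← ht]; module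

/-! ### Comparison with solutions in the weak sense -/

lemma IsMildSol.isSolution (hp : 1 ≤ p) (hcd : c < d) (h : IsMildSol p ι c d A f u w) :
    IsSolution p ι (Ioo c d) A f u w := by
  have hw := intervalIntegrable_of_memLp hp hcd.le h.memLp_deriv
  refine ⟨⟨h.memLp, h.memLp_deriv, ?_⟩, h.eqn, ⟨fun t => ∫ s in c..t, w s, ?_, ?_, ?_⟩⟩
  · intro φ hφ hc hs
    rw [← isWeakDeriv_integral hcd hw φ hφ hc hs]
    congr 1
    refine integral_congr_ae ?_
    filter_upwards [h.integral] with t ht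
    rw [ht]
  · rw [csInf_Ioo hcd]
    have := continuousOn_integral hw
    rw [uIcc_of_le hcd.le] at this
    exact this.mono (insert_subset (left_mem_Icc.2 hcd.le) Ioo_subset_Icc_self)
  · filter_upwards [h.integral] with t ht
    exact ht.symm
  · simp [csInf_Ioo hcd]

/-- The weak derivative fixes ιu up to a constant k. The continuous representative agrees with k
plus the primitive throughout the open interval, and its limit zero at the left endpoint forces k =
0. -/
lemma IsSolution.isMildSol (hp : 1 ≤ p) (hcd : c < d) (h : IsSolution p ι (Ioo c d) A f u w) :
    IsMildSol p ι c d A f u w := by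
  have hwi := intervalIntegrable_of_memLp hp hcd.le h.memMR.memLp_deriv
  refine ⟨h.memMR.memLp, h.memMR.memLp_deriv, h.eqn, ?_⟩
  obtain ⟨k, hk⟩ := h.memMR.weakDeriv.exists_ae_eq_add_integral hcd
    (integrableOn_of_memLp hp (memLp_clm ι h.memMR.memLp))
    (integrableOn_of_memLp hp h.memMR.memLp_deriv)
  obtain ⟨g, hg, hgv, hg0⟩ := h.init
  rw [csInf_Ioo hcd] at hg hg0
  have hF : ContinuousOn (fun t => k + ∫ s in c..t, w s) (Icc c d) := by
    have := continuousOn_integral hwi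
    rw [uIcc_of_le hcd.le] at this
    exact continuousOn_const.add this
  have heq : EqOn g (fun t => k + ∫ s in c..t, w s) (Ioo c d) := by
    refine Measure.eqOn_open_of_ae_eq (μ := volume) ?_ isOpen_Ioo
      (hg.mono (subset_insert _ _)) (hF.mono Ioo_subset_Icc_self)
    filter_upwards [hgv, hk] with t h1 h2
    rw [h1, h2]
  have hmem : (𝓝[Ioo c d] c).NeBot := by
    rw [nhdsWithin_Ioo_eq_nhdsGT hcd]; infer_instance
  have h1 : Tendsto g (𝓝[Ioo c d] c) (𝓝 0) := by
    have := (hg c (mem_insert _ _)).mono (subset_insert c (Ioo c d))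
    rwa [ContinuousWithinAt, hg0] at this
  have h2 : Tendsto (fun t => k + ∫ s in c..t, w s) (𝓝[Ioo c d] c) (𝓝 k) := by
    have := (hF c (left_mem_Icc.2 hcd.le)).mono (Ioo_subset_Icc_self (a := c) (b := d))
    rwa [ContinuousWithinAt, intervalIntegral.integral_same, add_zero] at this
  have h3 : k = 0 := tendsto_nhds_unique
    (h2.congr' (by filter_upwards [self_mem_nhdsWithin] with t ht using (heq ht).symm)) h1
  filter_upwards [hk] with t ht
  rw [ht, h3, zero_add]

lemma IsSolution.isMildSol_of_Ioi (hp : 1 ≤ p) (hd : 0 < d)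
    (h : IsSolution p ι (Ioi 0) A f u w) : IsMildSol p ι 0 d A f u w := by
  have hm : volume.restrict (Ioo 0 d) ≤ volume.restrict (Ioi 0) :=
    Measure.restrict_mono Ioo_subset_Ioi_self le_rfl
  refine IsSolution.isMildSol hp hd ⟨⟨h.memMR.memLp.mono_measure hm,
    h.memMR.memLp_deriv.mono_measure hm, h.memMR.weakDeriv.mono Ioo_subset_Ioi_self⟩,
    ae_mono hm h.eqn, ?_⟩
  obtain ⟨g, hg, hgv, hg0⟩ := h.init
  rw [csInf_Ioi] at hg hg0
  rw [VanishesAtLeft, csInf_Ioo hd]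
  exact ⟨g, hg.mono (insert_subset_insert Ioo_subset_Ioi_self), ae_mono hm hgv, hg0⟩

end Integrated

/-! ### The resolvent estimate for bounded semigroups -/

section Semigroup

/-- Multiply the differential inequality by pN^{p-1} and apply Young's inequality: (N^p)' ≤
l^{1-p}G^p - lN^p. Integrate, using N(c) = 0 and N(d) ≥ 0, and multiply by l^{p-1}. -/
lemma energy_estimate {N G : ℝ → ℝ} {c d l p : ℝ} (hp : 1 < p) (hl : 0 < l) (hcd : c ≤ d)
    (hN : AbsolutelyContinuousOnInterval N c d) (hN0 : ∀ t, 0 ≤ N t) (hNc : N c = 0)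
    (hG : ∀ t, 0 ≤ G t) (hGp : IntervalIntegrable (fun t => G t ^ p) volume c d)
    (h : ∀ᵐ t, t ∈ Ioo c d → deriv N t ≤ G t - l * N t) :
    l ^ p * ∫ t in c..d, N t ^ p ≤ ∫ t in c..d, G t ^ p := by
  have hp0 : 0 < p := by linarith
  have hrpow : ContDiff ℝ 1 (fun x : ℝ => x ^ p) := by
    have := Real.contDiff_rpow_const_of_le (p := p) (n := 1) (by simpa using hp.le)
    simpa using this
  obtain ⟨R, hR⟩ := hN.exists_bound
  -- N takes values in the bounded interval [0,R], where x ↦ x^p is Lipschitz.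
  have hΦ : AbsolutelyContinuousOnInterval (fun t => N t ^ p) c d := by
    obtain ⟨K, hK⟩ := (hrpow.contDiffOn (s := Icc 0 R)).exists_lipschitzOnWith (by decide)
      (convex_Icc _ _) isCompact_Icc
    have hmem : ∀ x ∈ uIcc c d, N x ∈ Icc 0 R := fun x hx =>
      ⟨hN0 x, (le_abs_self _).trans (hR x hx)⟩
    exact absolutelyContinuousOnInterval_of_dist_le hN fun x hx y hy =>
      hK.dist_le_mul _ (hmem x hx) _ (hmem y hy)
  have hNi : IntervalIntegrable (fun t => N t ^ p) volume c d := hΦ.continuousOn.intervalIntegrable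
  have hderiv : ∀ᵐ t, t ∈ Ioo c d →
      deriv (fun t => N t ^ p) t ≤ l ^ (1 - p) * G t ^ p - l * N t ^ p := by
    filter_upwards [h, hN.ae_differentiableAt] with t h1 h2 ht
    have h3 := (h2 (by rw [uIcc_of_le hcd]; exact Ioo_subset_Icc_self ht)).hasDerivAt
    rw [(h3.rpow_const (Or.inr hp.le)).deriv]
    have hpow : N t ^ p = N t ^ (p - 1) * N t := by
      rcases (hN0 t).eq_or_lt with h0 | h0
      · rw [← h0, Real.zero_rpow hp0.ne', mul_zero]
      · rw [← Real.rpow_add_one h0.ne']; congr 1; ring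
    -- Dividing G by l makes the N^p term of Young's inequality cost (p-1)l out of the available pl,
    -- so that l remains.
    have hy := Real.young_inequality_of_nonneg (a := N t ^ (p - 1)) (b := G t / l)
      (p := p / (p - 1)) (q := p) (Real.rpow_nonneg (hN0 t) _) (div_nonneg (hG t) hl.le)
      (Real.HolderConjugate.conjExponent hp).symm
    rw [← Real.rpow_mul (hN0 t), mul_div_cancel₀ _ (by linarith : p - 1 ≠ 0),
      Real.div_rpow (hG t) hl.le] at hy
    have hp1 : 0 ≤ N t ^ (p - 1) := Real.rpow_nonneg (hN0 t) _
    have h4 : deriv N t * p * N t ^ (p - 1) ≤ (G t - l * N t) * p * N t ^ (p - 1) := by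
      have := h1 ht
      gcongr
    refine h4.trans ?_
    have h5 : l ^ (1 - p) = l / l ^ p := by rw [Real.rpow_sub hl, Real.rpow_one]
    rw [h5]
    have h6 := mul_le_mul_of_nonneg_left hy (mul_pos hp0 hl).le
    have e1 : p * l * (N t ^ (p - 1) * (G t / l)) = p * (N t ^ (p - 1) * G t) := by
      field_simp
    have e2 : p * l * (N t ^ p / (p / (p - 1)) + G t ^ p / l ^ p / p)
        = (p - 1) * l * N t ^ p + l / l ^ p * G t ^ p := by
      field_simp
    rw [e1, e2] at h6
    have e3 : (G t - l * N t) * p * N t ^ (p - 1)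
        = p * (N t ^ (p - 1) * G t) - p * l * N t ^ p := by rw [hpow]; ring
    rw [e3]; linarith
  have hint := hΦ.integral_deriv_eq_sub
  have hmono : ∫ t in c..d, deriv (fun t => N t ^ p) t
      ≤ ∫ t in c..d, (l ^ (1 - p) * G t ^ p - l * N t ^ p) := by
    refine intervalIntegral.integral_mono_ae_restrict hcd hΦ.intervalIntegrable_deriv
      ((hGp.const_mul _).sub (hNi.const_mul _)) ?_
    rw [Measure.restrict_congr_set Ioo_ae_eq_Icc.symm, Filter.EventuallyLE,
      ae_restrict_iff' measurableSet_Ioo]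
    exact hderiv
  rw [hint, hNc, Real.zero_rpow hp0.ne', intervalIntegral.integral_sub (hGp.const_mul _)
    (hNi.const_mul _), intervalIntegral.integral_const_mul,
    intervalIntegral.integral_const_mul] at hmono
  have h7 : 0 ≤ N d ^ p := Real.rpow_nonneg (hN0 d) _
  have h8 : l * ∫ t in c..d, N t ^ p ≤ l ^ (1 - p) * ∫ t in c..d, G t ^ p := by linarith
  have h9 := mul_le_mul_of_nonneg_left h8 (Real.rpow_nonneg hl.le (p - 1))
  have e1 : l ^ (p - 1) * l = l ^ p := by rw [← Real.rpow_add_one hl.ne']; congr 1; ring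
  have e2 : l ^ (p - 1) * l ^ (1 - p) = 1 := by
    rw [← Real.rpow_add hl]; simp
  rwa [← mul_assoc, ← mul_assoc, e1, e2, one_mul] at h9

/-- The norm `sup_{τ ≥ 0} ‖S τ x‖`, for which the semigroup `S` is contractive. -/
def orbitNorm (S : ℝ → X →L[ℝ] X) (x : X) : ℝ := ⨆ τ : Ici (0 : ℝ), ‖S τ x‖

variable {p : ℝ} {ι A₀ : D →L[ℝ] X} {S : ℝ → X →L[ℝ] X} {M : ℝ}

lemma bddAbove_orbit (hM : ∀ τ, 0 ≤ τ → ‖S τ‖ ≤ M) (x : X) :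
    BddAbove (range fun τ : Ici (0 : ℝ) => ‖S τ x‖) :=
  ⟨M * ‖x‖, by rintro _ ⟨τ, rfl⟩; exact (S τ).le_of_opNorm_le (hM τ τ.2) x⟩

lemma norm_le_orbitNorm (hM : ∀ τ, 0 ≤ τ → ‖S τ‖ ≤ M) (x : X) {τ : ℝ} (hτ : 0 ≤ τ) :
    ‖S τ x‖ ≤ orbitNorm S x :=
  le_ciSup (bddAbove_orbit hM x) ⟨τ, hτ⟩

lemma orbitNorm_le {x : X} {C : ℝ} (h : ∀ τ, 0 ≤ τ → ‖S τ x‖ ≤ C) : orbitNorm S x ≤ C :=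
  ciSup_le fun τ => h τ τ.2

lemma orbitNorm_le_mul (hM : ∀ τ, 0 ≤ τ → ‖S τ‖ ≤ M) (x : X) : orbitNorm S x ≤ M * ‖x‖ :=
  orbitNorm_le fun τ hτ => (S τ).le_of_opNorm_le (hM τ hτ) x

lemma orbitNorm_add_le (hM : ∀ τ, 0 ≤ τ → ‖S τ‖ ≤ M) (x y : X) :
    orbitNorm S (x + y) ≤ orbitNorm S x + orbitNorm S y :=
  orbitNorm_le fun τ hτ => by
    rw [map_add]
    exact (norm_add_le _ _).trans
      (add_le_add (norm_le_orbitNorm hM x hτ) (norm_le_orbitNorm hM y hτ))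

lemma orbitNorm_smul_le (hM : ∀ τ, 0 ≤ τ → ‖S τ‖ ≤ M) {r : ℝ} (hr : 0 ≤ r) (x : X) :
    orbitNorm S (r • x) ≤ r * orbitNorm S x :=
  orbitNorm_le fun τ hτ => by
    rw [map_smul, norm_smul, Real.norm_of_nonneg hr]
    exact mul_le_mul_of_nonneg_left (norm_le_orbitNorm hM x hτ) hr

lemma orbitNorm_nonneg (S : ℝ → X →L[ℝ] X) (x : X) : 0 ≤ orbitNorm S x :=
  Real.iSup_nonneg fun _ => norm_nonneg _

lemma dist_orbitNorm_le (hM : ∀ τ, 0 ≤ τ → ‖S τ‖ ≤ M) (x y : X) :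
    dist (orbitNorm S x) (orbitNorm S y) ≤ M * dist x y := by
  have key : ∀ x y : X, orbitNorm S x - orbitNorm S y ≤ M * dist x y := fun x y => by
    have h1 := orbitNorm_add_le hM (x - y) y
    have h2 := orbitNorm_le_mul hM (x - y)
    rw [sub_add_cancel] at h1
    rw [dist_eq_norm]; linarith
  rw [Real.dist_eq, abs_le]
  have := key y x
  rw [dist_comm y x] at this
  exact ⟨by linarith, key x y⟩

lemma continuous_orbitNorm (hM : ∀ τ, 0 ≤ τ → ‖S τ‖ ≤ M) : Continuous (orbitNorm S) := by
  have hM0 : 0 ≤ M := (norm_nonneg _).trans (hM 0 le_rfl)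
  exact (LipschitzWith.of_dist_le_mul (K := ⟨M, hM0⟩) (dist_orbitNorm_le hM)).continuous

/-- The orbit of S(h)x is a tail of the orbit of x: this is the contractivity gained by renorming.
-/
lemma orbitNorm_apply_le (hS : IsSemigroupOf ι A₀ S) (hM : ∀ τ, 0 ≤ τ → ‖S τ‖ ≤ M) {h : ℝ}
    (hh : 0 ≤ h) (x : X) : orbitNorm S (S h x) ≤ orbitNorm S x :=
  orbitNorm_le fun τ hτ => by
    rw [← ContinuousLinearMap.comp_apply, ← hS.add τ h hτ hh]
    exact norm_le_orbitNorm hM x (add_nonneg hτ hh)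

/-- A substitute for dissipativity that avoids duality maps. To first order v(t+h) is (1-lh)S(h)v(t)
+ hq(h), where q(h) tends to w + A₀x + lv(t) by the definition of the generator. Contractivity in
the orbit norm bounds the right difference quotient, which equals the derivative where it exists. -/
lemma deriv_orbitNorm_le (hS : IsSemigroupOf ι A₀ S) (hM : ∀ τ, 0 ≤ τ → ‖S τ‖ ≤ M)
    {v : ℝ → X} {x : D} {w : X} {t l : ℝ} (hv : HasDerivAt v w t) (hx : ι x = v t)
    (hd : DifferentiableAt ℝ (fun s => orbitNorm S (v s)) t) :
    deriv (fun s => orbitNorm S (v s)) t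
      ≤ orbitNorm S (w + A₀ x + l • v t) - l * orbitNorm S (v t) := by
  have h1 : Tendsto (fun h : ℝ => h⁻¹ • (v (t + h) - v t)) (𝓝[>] 0) (𝓝 w) :=
    hv.tendsto_slope_zero_right
  have h2 : Tendsto (fun h : ℝ => h⁻¹ • (S h (v t) - v t)) (𝓝[>] 0) (𝓝 (-(A₀ x))) :=
    (hS.generator _ _).2 ⟨x, hx, rfl⟩
  have h3 : Tendsto (fun h : ℝ => h⁻¹ • (v (t + h) - v t) - h⁻¹ • (S h (v t) - v t)
      + l • S h (v t)) (𝓝[>] 0) (𝓝 (w + A₀ x + l • v t)) := by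
    have := (h1.sub h2).add ((hS.cont (v t)).const_smul l)
    rwa [sub_neg_eq_add] at this
  have h4 := ((continuous_orbitNorm hM).tendsto _).comp h3
  have h5 := hd.hasDerivAt.tendsto_slope_zero_right
  refine le_of_tendsto_of_tendsto h5 (h4.sub_const (l * orbitNorm S (v t))) ?_
  -- The coefficient 1 - lh must be nonnegative to come out of the norm.
  have hsmall : ∀ᶠ h : ℝ in 𝓝[>] 0, l * h < 1 := by
    have : Tendsto (fun h : ℝ => l * h) (𝓝[>] 0) (𝓝 (l * 0)) :=
      ((continuous_const.mul continuous_id).tendsto 0).mono_left nhdsWithin_le_nhds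
    rw [mul_zero] at this
    exact this.eventually (gt_mem_nhds one_pos)
  filter_upwards [self_mem_nhdsWithin, hsmall] with h hh hlh
  have hh0 : 0 < h := hh
  set q := h⁻¹ • (v (t + h) - v t) - h⁻¹ • (S h (v t) - v t) + l • S h (v t) with hq
  have e : v (t + h) = (1 - l * h) • S h (v t) + h • q := by
    rw [hq]
    simp only [smul_add, smul_sub, smul_smul, mul_inv_cancel₀ hh0.ne', one_smul]
    module
  have h6 : orbitNorm S (v (t + h)) ≤ (1 - l * h) * orbitNorm S (v t) + h * orbitNorm S q := by
    rw [e]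
    refine (orbitNorm_add_le hM _ _).trans (add_le_add ?_ (orbitNorm_smul_le hM hh0.le _))
    refine (orbitNorm_smul_le hM (by linarith) _).trans ?_
    exact mul_le_mul_of_nonneg_left (orbitNorm_apply_le hS hM hh0.le _) (by linarith)
  simp only [Function.comp, smul_eq_mul]
  rw [inv_mul_le_iff₀ hh0]
  linarith

variable [CompleteSpace X]

/-- Apply the energy inequality to N(t), the orbit norm of ιu(t). It is absolutely continuous
because the orbit norm is Lipschitz, and N' ≤ M‖g‖ - lN. Since ‖x‖ ≤ orbit norm ≤ M‖x‖, only one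
factor M is lost. The bound does not depend on the length of the interval. -/
lemma IsMildSol.resolvent_estimate {c d l : ℝ} {g : ℝ → X} {u : ℝ → D} {w : ℝ → X}
    (hp : 1 < p) (hcd : c ≤ d) (hl : 0 < l) (hS : IsSemigroupOf ι A₀ S)
    (hM : ∀ τ, 0 ≤ τ → ‖S τ‖ ≤ M)
    (hg : MemLp g (ENNReal.ofReal p) (volume.restrict (Ioo c d)))
    (h : IsMildSol p ι c d (fun _ => A₀ + l • ι) g u w) :
    ENNReal.ofReal l * eLpNorm (fun t => ι (u t)) (ENNReal.ofReal p) (volume.restrict (Ioo c d))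
      ≤ ENNReal.ofReal M * eLpNorm g (ENNReal.ofReal p) (volume.restrict (Ioo c d)) := by
  have hp0 : 0 < p := by linarith
  have hM0 : 0 ≤ M := (norm_nonneg _).trans (hM 0 le_rfl)
  have hw := intervalIntegrable_of_memLp hp.le hcd h.memLp_deriv
  set v : ℝ → X := fun t => ∫ s in c..t, w s with hv
  have hN : AbsolutelyContinuousOnInterval (fun t => orbitNorm S (v t)) c d :=
    absolutelyContinuousOnInterval_of_dist_le (absolutelyContinuousOnInterval_integral hw)
      fun x _ y _ => dist_orbitNorm_le hM _ _
  have hq : (ENNReal.ofReal p).toReal = p := ENNReal.toReal_ofReal hp0.le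
  have hq0 : ENNReal.ofReal p ≠ 0 := (ENNReal.ofReal_pos.2 hp0).ne'
  have hgi : IntegrableOn (fun t => ‖g t‖ ^ p) (Ioo c d) := by
    have := hg.integrable_norm_rpow hq0 ENNReal.ofReal_ne_top
    rwa [hq] at this
  have hGp : IntervalIntegrable (fun t => (M * ‖g t‖) ^ p) volume c d := by
    simp only [Real.mul_rpow hM0 (norm_nonneg _)]
    exact ((intervalIntegrable_iff_integrableOn_Ioo_of_le hcd).2 hgi).const_mul _
  have hen := energy_estimate (l := l) (G := fun t => M * ‖g t‖) hp hl hcd hN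
    (fun t => orbitNorm_nonneg S _) (by
      simp only [hv, intervalIntegral.integral_same]
      exact le_antisymm (by simpa using orbitNorm_le_mul hM (0 : X)) (orbitNorm_nonneg S _))
    (fun t => mul_nonneg hM0 (norm_nonneg _)) hGp (by
      filter_upwards [hN.ae_differentiableAt, hw.ae_hasDerivAt_integral,
        (ae_restrict_iff' measurableSet_Ioo).1 h.eqn,
        (ae_restrict_iff' measurableSet_Ioo).1 h.integral] with t h1 h2 h3 h4 ht
      have ht' : t ∈ uIcc c d := by rw [uIcc_of_le hcd]; exact Ioo_subset_Icc_self ht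
      refine (deriv_orbitNorm_le (l := l) hS hM (h2 ht' c left_mem_uIcc) (h4 ht) (h1 ht')).trans ?_
      have h5 : w t + A₀ (u t) + l • v t = g t := by
        rw [← h3 ht, hv]
        simp only [add_apply, smul_apply]
        rw [← h4 ht, add_assoc]
      rw [h5]
      exact sub_le_sub_right (orbitNorm_le_mul hM _) _)
  have hNi : IntegrableOn (fun t => orbitNorm S (v t) ^ p) (Ioo c d) := by
    refine (intervalIntegrable_iff_integrableOn_Ioo_of_le hcd).1 ?_
    exact (hN.continuousOn.rpow_const fun _ _ => Or.inr hp0.le).intervalIntegrable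
  have hιu := memLp_clm ι h.memLp
  have hvi : IntegrableOn (fun t => ‖ι (u t)‖ ^ p) (Ioo c d) := by
    have := hιu.integrable_norm_rpow hq0 ENNReal.ofReal_ne_top
    rwa [hq] at this
  have hle : ∫ t in Ioo c d, ‖ι (u t)‖ ^ p ≤ ∫ t in Ioo c d, orbitNorm S (v t) ^ p := by
    refine integral_mono_ae hvi hNi ?_
    filter_upwards [h.integral] with t ht
    refine Real.rpow_le_rpow (norm_nonneg _) ?_ hp0.le
    rw [ht]
    have := norm_le_orbitNorm hM (v t) le_rfl
    rwa [hS.zero] at this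
  rw [intervalIntegral.integral_of_le hcd, intervalIntegral.integral_of_le hcd,
    integral_Ioc_eq_integral_Ioo, integral_Ioc_eq_integral_Ioo] at hen
  simp only [Real.mul_rpow hM0 (norm_nonneg _)] at hen
  rw [integral_const_mul] at hen
  rw [hιu.eLpNorm_eq_integral_rpow_norm hq0 ENNReal.ofReal_ne_top,
    hg.eLpNorm_eq_integral_rpow_norm hq0 ENNReal.ofReal_ne_top, hq,
    ← ENNReal.ofReal_mul hl.le, ← ENNReal.ofReal_mul hM0]
  refine ENNReal.ofReal_le_ofReal ?_
  have hroot : ∀ r : ℝ, 0 ≤ r → r = (r ^ p) ^ p⁻¹ := fun r hr =>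
    (Real.rpow_rpow_inv hr hp0.ne').symm
  have hI1 : 0 ≤ ∫ t in Ioo c d, ‖ι (u t)‖ ^ p := by positivity
  have hI2 : 0 ≤ ∫ t in Ioo c d, ‖g t‖ ^ p := by positivity
  calc l * (∫ t in Ioo c d, ‖ι (u t)‖ ^ p) ^ p⁻¹
      = (l ^ p * ∫ t in Ioo c d, ‖ι (u t)‖ ^ p) ^ p⁻¹ := by
        rw [Real.mul_rpow (by positivity) hI1, ← hroot l hl.le]
    _ ≤ (M ^ p * ∫ t in Ioo c d, ‖g t‖ ^ p) ^ p⁻¹ := by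
        refine Real.rpow_le_rpow (by positivity) (le_trans ?_ hen) (by positivity)
        exact mul_le_mul_of_nonneg_left hle (by positivity)
    _ = M * (∫ t in Ioo c d, ‖g t‖ ^ p) ^ p⁻¹ := by
        rw [Real.mul_rpow (by positivity) hI2, ← hroot M hM0]

end Semigroup

/-! ### Autonomous operators on bounded intervals -/

section Autonomous

variable {p : ℝ} {ι A₀ : D →L[ℝ] X} {S : ℝ → X →L[ℝ] X} {M c d : ℝ} {f g : ℝ → X}
  {u u' : ℝ → D} {w w' : ℝ → X}

/-- The initial value problem for `A` on `(c,d)` is uniquely solvable, and the norm in `L^p(D)` of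
its solutions is at most `κ` times the norm of the data. -/
def WellPosed (p : ℝ) (ι : D →L[ℝ] X) (A : ℝ → D →L[ℝ] X) (c d : ℝ) (κ : ℝ≥0∞) : Prop :=
  ∀ f : ℝ → X, MemLp f (ENNReal.ofReal p) (volume.restrict (Ioo c d)) →
    (∃ u w, IsMildSol p ι c d A f u w) ∧
    ∀ u w, IsMildSol p ι c d A f u w →
      eLpNorm u (ENNReal.ofReal p) (volume.restrict (Ioo c d))
        ≤ κ * eLpNorm f (ENNReal.ofReal p) (volume.restrict (Ioo c d))

lemma eLpNorm_le_mrNorm (hp : 0 < p) (I : Set ℝ) (u : ℝ → D) (w : ℝ → X) :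
    eLpNorm u (ENNReal.ofReal p) (volume.restrict I) ≤ mrNorm p ι I u w := by
  unfold mrNorm
  calc eLpNorm u (ENNReal.ofReal p) (volume.restrict I)
      = (eLpNorm u (ENNReal.ofReal p) (volume.restrict I) ^ p) ^ (1 / p) := by
        rw [one_div, ENNReal.rpow_rpow_inv hp.ne']
    _ ≤ _ := by
        refine ENNReal.rpow_le_rpow ?_ (by positivity)
        exact le_add_right le_add_self

variable [CompleteSpace X]

/-- The weighted difference of two solutions solves the problem shifted by 1 with zero data, so the
resolvent estimate makes it vanish in X, and ι is injective. -/
lemma IsMildSol.ae_eq_of_semigroup (hp : 1 < p) (hι : Function.Injective ι) (hcd : c ≤ d)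
    (hS : IsSemigroupOf ι A₀ S) (hM : ∀ τ, 0 ≤ τ → ‖S τ‖ ≤ M)
    (h : IsMildSol p ι c d (fun _ => A₀) f u w) (h' : IsMildSol p ι c d (fun _ => A₀) f u' w') :
    u =ᵐ[volume.restrict (Ioo c d)] u' := by
  have h1 := ((h.sub hp.le h').exp_smul hp.le 1).resolvent_estimate hp hcd one_pos hS hM
    (by simp)
  have hq0 : ENNReal.ofReal p ≠ 0 := (ENNReal.ofReal_pos.2 (by linarith)).ne'
  have h2 := ((h.sub hp.le h').exp_smul hp.le 1).memLp
  simp only [sub_self, smul_zero, eLpNorm_zero', mul_zero, ENNReal.ofReal_one, one_mul,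
    nonpos_iff_eq_zero] at h1
  rw [eLpNorm_eq_zero_iff (memLp_clm ι h2).1 hq0] at h1
  filter_upwards [h1] with t ht
  have h3 := hι (ht.trans (map_zero ι).symm)
  rw [smul_eq_zero] at h3
  exact sub_eq_zero.1 (h3.resolve_left (Real.exp_pos _).ne')

/-- Translate to start at 0, extend the data by zero to the half-line, solve there, and restrict. -/
lemma exists_isMildSol_of_hasAutMR (hp : 1 ≤ p) (hcd : c < d) (hA : HasAutMR p ι (Ioi 0) A₀)
    (hf : MemLp f (ENNReal.ofReal p) (volume.restrict (Ioo c d))) :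
    ∃ u w, IsMildSol p ι c d (fun _ => A₀) f u w := by
  have hm := measurePreserving_add_Ioo c d c
  rw [sub_self] at hm
  have hf' := hf.comp_measurePreserving hm
  have hsub : Ioo 0 (d - c) ⊆ Ioi 0 := Ioo_subset_Ioi_self
  obtain ⟨u, w, huw⟩ := hA.exists_solution ((Ioo 0 (d - c)).indicator fun t => f (t + c)) (by
    rw [memLp_indicator_iff_restrict measurableSet_Ioo,
      Measure.restrict_restrict measurableSet_Ioo, inter_eq_left.2 hsub]
    exact hf')
  have h1 := (huw.isMildSol_of_Ioi hp (sub_pos.2 hcd)).comp_add (-c)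
  rw [sub_neg_eq_add, sub_neg_eq_add, zero_add, sub_add_cancel] at h1
  refine ⟨_, _, h1.congr ?_⟩
  filter_upwards [h1.eqn, ae_restrict_mem measurableSet_Ioo] with t ht htI
  rw [ht, indicator_of_mem (by constructor <;> linarith [htI.1, htI.2]), neg_add_cancel_right]

/-- The constant on (a,b) serves every interval of at most that length: extend the data by zero to
length b - a and translate to (a,b). Uniqueness identifies the new solution with the old one on the
shorter interval. -/
lemma eLpNorm_le_of_isMRBound {a b : ℝ} {K : ℝ≥0∞} (hp : 1 < p) (hι : Function.Injective ι)
    (hcd : c < d) (hab : d - c ≤ b - a) (hA : HasAutMR p ι (Ioi 0) A₀)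
    (hS : IsSemigroupOf ι A₀ S) (hM : ∀ τ, 0 ≤ τ → ‖S τ‖ ≤ M)
    (hK : IsMRBound p ι (Ioo a b) (fun _ => A₀) K)
    (hf : MemLp f (ENNReal.ofReal p) (volume.restrict (Ioo c d)))
    (h : IsMildSol p ι c d (fun _ => A₀) f u w) :
    eLpNorm u (ENNReal.ofReal p) (volume.restrict (Ioo c d))
      ≤ K * eLpNorm f (ENNReal.ofReal p) (volume.restrict (Ioo c d)) := by
  set e := c + (b - a) with he
  have hde : d ≤ e := by rw [he]; linarith
  have hsub : Ioo c d ⊆ Ioo c e := Ioo_subset_Ioo_right hde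
  have hgm : MemLp ((Ioo c d).indicator f) (ENNReal.ofReal p) (volume.restrict (Ioo c e)) := by
    rw [memLp_indicator_iff_restrict measurableSet_Ioo,
      Measure.restrict_restrict measurableSet_Ioo, inter_eq_left.2 hsub]
    exact hf
  obtain ⟨U, W, hU⟩ := exists_isMildSol_of_hasAutMR hp.le (hcd.trans_le hde) hA hgm
  have hUu : u =ᵐ[volume.restrict (Ioo c d)] U := by
    refine h.ae_eq_of_semigroup hp hι hcd.le hS hM ((hU.mono hde).congr ?_) 
    filter_upwards [(hU.mono hde).eqn, ae_restrict_mem measurableSet_Ioo] with t ht htI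
    rw [ht, indicator_of_mem htI]
  have hT := hU.comp_add (c - a)
  have hm := measurePreserving_add_Ioo c e (c - a)
  have e1 : c - (c - a) = a := by ring
  have e2 : e - (c - a) = b := by rw [he]; ring
  rw [e1, e2] at hT hm
  have hbd := hK _ _ _ (hgm.comp_measurePreserving hm)
    (hT.isSolution hp.le (by linarith : a < b))
  calc eLpNorm u (ENNReal.ofReal p) (volume.restrict (Ioo c d))
      = eLpNorm U (ENNReal.ofReal p) (volume.restrict (Ioo c d)) := eLpNorm_congr_ae hUu
    _ ≤ eLpNorm U (ENNReal.ofReal p) (volume.restrict (Ioo c e)) :=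
        eLpNorm_mono_measure _ (Measure.restrict_mono hsub le_rfl)
    _ = eLpNorm (fun t => U (t + (c - a))) (ENNReal.ofReal p) (volume.restrict (Ioo a b)) :=
        (eLpNorm_comp_measurePreserving hU.memLp.1 hm).symm
    _ ≤ mrNorm p ι (Ioo a b) (fun t => U (t + (c - a))) (fun t => W (t + (c - a))) :=
        eLpNorm_le_mrNorm (by linarith) _ _ _
    _ ≤ K * eLpNorm ((Ioo c d).indicator f ∘ fun t => t + (c - a)) (ENNReal.ofReal p)
          (volume.restrict (Ioo a b)) := hbd
    _ = K * eLpNorm f (ENNReal.ofReal p) (volume.restrict (Ioo c d)) := by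
        rw [eLpNorm_comp_measurePreserving hgm.1 hm,
          eLpNorm_indicator_eq_eLpNorm_restrict measurableSet_Ioo,
          Measure.restrict_restrict measurableSet_Ioo, inter_eq_left.2 hsub]

lemma exists_isMildSol_shift {A : ℝ → D →L[ℝ] X} (hp : 1 ≤ p) (l : ℝ)
    (hA : ∀ f : ℝ → X, MemLp f (ENNReal.ofReal p) (volume.restrict (Ioo c d)) →
      ∃ u w, IsMildSol p ι c d A f u w)
    (hf : MemLp f (ENNReal.ofReal p) (volume.restrict (Ioo c d))) :
    ∃ u w, IsMildSol p ι c d (fun t => A t + l • ι) f u w := by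
  obtain ⟨u, w, h⟩ := hA (fun t => Real.exp (l * (t - c)) • f t)
    (memLp_continuous_smul (by fun_prop) hf)
  refine ⟨_, _, (h.exp_smul hp l).congr ?_⟩
  filter_upwards [(h.exp_smul hp l).eqn] with t ht
  rw [ht, smul_smul, ← Real.exp_add]
  simp

/-- Move l ιu to the data: the resolvent estimate bounds the new data by (1+M)‖f‖, whatever l is.
This uniformity allows l to be chosen large later. -/
lemma eLpNorm_le_of_isMRBound_shift {a b l : ℝ} {K : ℝ≥0∞} (hp : 1 < p)
    (hι : Function.Injective ι) (hcd : c < d) (hab : d - c ≤ b - a) (hl : 0 < l)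
    (hA : HasAutMR p ι (Ioi 0) A₀) (hS : IsSemigroupOf ι A₀ S) (hM : ∀ τ, 0 ≤ τ → ‖S τ‖ ≤ M)
    (hK : IsMRBound p ι (Ioo a b) (fun _ => A₀) K)
    (hf : MemLp f (ENNReal.ofReal p) (volume.restrict (Ioo c d)))
    (h : IsMildSol p ι c d (fun _ => A₀ + l • ι) f u w) :
    eLpNorm u (ENNReal.ofReal p) (volume.restrict (Ioo c d))
      ≤ K * (1 + ENNReal.ofReal M) *
        eLpNorm f (ENNReal.ofReal p) (volume.restrict (Ioo c d)) := by
  have hιu := memLp_clm ι h.memLp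
  have h1 : IsMildSol p ι c d (fun _ => A₀) (fun t => f t - l • ι (u t)) u w := by
    refine h.congr ?_
    filter_upwards [h.eqn] with t ht
    rw [← ht, add_apply, smul_apply]; abel
  have hp1 : 1 ≤ ENNReal.ofReal p := ENNReal.one_le_ofReal.2 hp.le
  have h2 := eLpNorm_le_of_isMRBound hp hι hcd hab hA hS hM hK (hf.sub (hιu.const_smul l)) h1
  have h3 := h.resolvent_estimate hp hcd.le hl hS hM hf
  refine h2.trans ?_
  rw [mul_assoc, add_mul, one_mul]
  gcongr
  refine (eLpNorm_sub_le hf.1 (hιu.const_smul l).1 hp1).trans ?_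
  gcongr
  refine le_trans (le_of_eq ?_) h3
  have := eLpNorm_const_smul l (fun t => ι (u t)) (ENNReal.ofReal p) (volume.restrict (Ioo c d))
  rw [Real.enorm_of_nonneg hl.le] at this
  exact this

end Autonomous

/-! ### Perturbation on short intervals -/

section Perturbation

variable {p : ℝ} {ι A₀ : D →L[ℝ] X} {A B : ℝ → D →L[ℝ] X} {S : ℝ → X →L[ℝ] X} {M c d : ℝ}
  {f g : ℝ → X} {u u' : ℝ → D} {w w' : ℝ → X}

/-- Approximate u by simple functions, for which A(t)u(t) is a finite sum of indicators of strongly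
measurable functions, and use continuity of each A(t). -/
lemma aestronglyMeasurable_clm_apply {μ : Measure ℝ}
    (hA : ∀ x : D, AEStronglyMeasurable (fun t => A t x) μ) (hu : AEStronglyMeasurable u μ) :
    AEStronglyMeasurable (fun t => A t (u t)) μ := by
  obtain ⟨v, hv, huv⟩ := hu
  have hs : ∀ n, AEStronglyMeasurable (fun t => A t (hv.approx n t)) μ := fun n => by
    have e : (fun t => A t (hv.approx n t)) = fun t => ∑ x ∈ (hv.approx n).range,
        ((hv.approx n) ⁻¹' {x}).indicator (fun t => A t x) t := by
      funext t
      rw [Finset.sum_eq_single (hv.approx n t)]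
      · rw [indicator_of_mem (by simp)]
      · intro x _ hx
        rw [indicator_of_notMem]
        simpa using Ne.symm hx
      · intro h
        exact absurd (SimpleFunc.mem_range_self _ t) h
    rw [e]
    exact Finset.aestronglyMeasurable_fun_sum _ fun x _ =>
      (hA x).indicator ((hv.approx n).measurableSet_preimage {x})
  refine (aestronglyMeasurable_of_tendsto_ae atTop hs (g := fun t => A t (v t)) ?_).congr ?_
  · filter_upwards with t
    exact ((A t).continuous.tendsto _).comp (hv.tendsto_approx t)
  · filter_upwards [huv] with t ht
    rw [ht]

lemma memLp_clm_apply {q : ℝ≥0∞} {μ : Measure ℝ} {L : ℝ}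
    (hA : ∀ x : D, AEStronglyMeasurable (fun t => A t x) μ) (hL : ∀ᵐ t ∂μ, ‖A t‖ ≤ L)
    (hu : MemLp u q μ) : MemLp (fun t => A t (u t)) q μ := by
  refine hu.of_le_mul (c := L) (aestronglyMeasurable_clm_apply hA hu.1) ?_
  filter_upwards [hL] with t ht using (A t).le_of_opNorm_le ht _

lemma eLpNorm_perturbation_le {q : ℝ≥0∞} {μ : Measure ℝ} {ε η : ℝ} (hq : 1 ≤ q)
    (hε : 0 ≤ ε) (hη : 0 ≤ η)
    (hB : ∀ᵐ t ∂μ, ∀ x, ‖B t x‖ ≤ ε * ‖x‖ + η * ‖ι x‖) (hu : MemLp u q μ) :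
    eLpNorm (fun t => B t (u t)) q μ
      ≤ ENNReal.ofReal ε * eLpNorm u q μ + ENNReal.ofReal η * eLpNorm (fun t => ι (u t)) q μ := by
  have hιu := memLp_clm ι hu
  calc eLpNorm (fun t => B t (u t)) q μ
      ≤ eLpNorm (fun t => ε * ‖u t‖ + η * ‖ι (u t)‖) q μ := by
        refine eLpNorm_mono_ae ?_
        filter_upwards [hB] with t ht
        exact (ht _).trans (le_abs_self _)
    _ ≤ eLpNorm (fun t => ε * ‖u t‖) q μ + eLpNorm (fun t => η * ‖ι (u t)‖) q μ :=
        eLpNorm_add_le (hu.norm.const_mul ε).1 (hιu.norm.const_mul η).1 hq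
    _ = _ := by
        have h1 := eLpNorm_const_smul ε (fun t => ‖u t‖) q μ
        have h2 := eLpNorm_const_smul η (fun t => ‖ι (u t)‖) q μ
        rw [Real.enorm_of_nonneg hε, eLpNorm_norm] at h1
        rw [Real.enorm_of_nonneg hη, eLpNorm_norm] at h2
        exact congrArg₂ (· + ·) h1 h2

/-- Solvability of a perturbed problem by a contraction argument in the space of data. -/
lemma wellPosed_of_contraction [CompleteSpace X] {A₁ : D →L[ℝ] X} {κ : ℝ≥0∞} (hp : 1 ≤ p)
    (hBm : ∀ u : ℝ → D, MemLp u (ENNReal.ofReal p) (volume.restrict (Ioo c d)) →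
      MemLp (fun t => B t (u t)) (ENNReal.ofReal p) (volume.restrict (Ioo c d)))
    (h0 : WellPosed p ι (fun _ => A₁) c d κ)
    (hB : ∀ g u w, MemLp g (ENNReal.ofReal p) (volume.restrict (Ioo c d)) →
      IsMildSol p ι c d (fun _ => A₁) g u w →
      eLpNorm (fun t => B t (u t)) (ENNReal.ofReal p) (volume.restrict (Ioo c d))
        ≤ ENNReal.ofReal (3 / 4) * eLpNorm g (ENNReal.ofReal p) (volume.restrict (Ioo c d))) :
    WellPosed p ι (fun t => A₁ + B t) c d (κ * 4) := by
  intro f hf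
  have : Fact (1 ≤ ENNReal.ofReal p) := ⟨ENNReal.one_le_ofReal.2 hp⟩
  constructor
  -- R is an arbitrary choice of solutions and need not be linear: Rg - Rg' is a solution with data
  -- g - g', to which the bound applies directly. A fixed point of g ↦ f - B R g gives the solution
  -- R g.
  · choose R W hR using fun g : Lp X (ENNReal.ofReal p) (volume.restrict (Ioo c d)) =>
      (h0 g (Lp.memLp g)).1
    let Φ : Lp X (ENNReal.ofReal p) (volume.restrict (Ioo c d)) →
        Lp X (ENNReal.ofReal p) (volume.restrict (Ioo c d)) := fun g =>
      (hf.sub (hBm _ (hR g).memLp)).toLp _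
    have hΦ : ContractingWith (3 / 4) Φ := by
      refine ⟨by rw [← NNReal.coe_lt_coe]; norm_num, fun g g' => ?_⟩
      have h1 := hB _ _ _ ((Lp.memLp g).sub (Lp.memLp g')) ((hR g).sub hp (hR g'))
      have e1 : edist (Φ g) (Φ g') = eLpNorm (fun t => B t (R g t - R g' t)) (ENNReal.ofReal p)
          (volume.restrict (Ioo c d)) := by
        rw [Lp.edist_toLp_toLp, ← eLpNorm_neg]
        congr 1
        funext t
        simp [map_sub]
      have e2 : ((3 / 4 : NNReal) : ℝ≥0∞) = ENNReal.ofReal (3 / 4) := by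
        rw [ENNReal.ofReal]
        congr 1
        rw [← NNReal.coe_inj, Real.coe_toNNReal _ (by norm_num)]
        norm_num
      rw [e1, e2, Lp.edist_def]
      exact h1
    obtain ⟨g, hg, -⟩ := hΦ.exists_fixedPoint 0 (edist_ne_top _ _)
    refine ⟨R g, W g, (hR g).congr ?_⟩
    have hg' : (g : ℝ → X) =ᵐ[volume.restrict (Ioo c d)] fun t => f t - B t (R g t) := by
      conv_lhs => rw [← hg.eq]
      exact MemLp.coeFn_toLp _
    filter_upwards [(hR g).eqn, hg'] with t h1 h2
    rw [add_apply, ← add_assoc, h1, h2, sub_add_cancel]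
  · intro u w h
    have hBu := hBm u h.memLp
    have h1 : IsMildSol p ι c d (fun _ => A₁) (fun t => f t - B t (u t)) u w := by
      refine h.congr ?_
      filter_upwards [h.eqn] with t ht
      rw [← ht, add_apply]; abel
    have hgm : MemLp (fun t => f t - B t (u t)) (ENNReal.ofReal p) (volume.restrict (Ioo c d)) :=
      hf.sub hBu
    have h2 := hB _ u w hgm h1
    have h3 := (h0 _ hgm).2 u w h1
    set G := eLpNorm (fun t => f t - B t (u t)) (ENNReal.ofReal p) (volume.restrict (Ioo c d))
    set F := eLpNorm f (ENNReal.ofReal p) (volume.restrict (Ioo c d))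
    have h4 : G ≤ F + ENNReal.ofReal (3 / 4) * G :=
      (eLpNorm_sub_le hf.1 hBu.1 Fact.out).trans (add_le_add le_rfl h2)
    have hGt : G ≠ ⊤ := hgm.2.ne
    have hFt : F ≠ ⊤ := hf.2.ne
    -- 4 = 1/(1 - 3/4); absorbing the last term is legitimate because G is finite.
    have h5 : G ≤ 4 * F := by
      rw [← ENNReal.ofReal_toReal hGt, ← ENNReal.ofReal_toReal hFt] at h4 ⊢
      rw [← ENNReal.ofReal_mul (by norm_num), ← ENNReal.ofReal_add (by positivity) (by positivity),
        ENNReal.ofReal_le_ofReal_iff (by positivity)] at h4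
      rw [show (4 : ℝ≥0∞) = ENNReal.ofReal 4 by simp, ← ENNReal.ofReal_mul (by norm_num)]
      exact ENNReal.ofReal_le_ofReal (by linarith)
    rw [mul_assoc]
    exact h3.trans (mul_le_mul_right h5 κ)

/-- The weight e^{-l(t-c)} is at most 1 on the data and at least e^{-l(d-c)} on the solution. -/
lemma WellPosed.unshift [CompleteSpace X] {l : ℝ} {κ : ℝ≥0∞} (hp : 1 ≤ p) (hl : 0 ≤ l)
    (h : WellPosed p ι (fun t => A t + l • ι) c d κ) :
    WellPosed p ι A c d (ENNReal.ofReal (Real.exp (l * (d - c))) * κ) := by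
  intro f hf
  have hf' : MemLp (fun t => Real.exp (-l * (t - c)) • f t) (ENNReal.ofReal p)
      (volume.restrict (Ioo c d)) := memLp_continuous_smul (by fun_prop) hf
  constructor
  · obtain ⟨u, w, huw⟩ := exists_isMildSol_shift hp (-l) (fun f hf => (h f hf).1) hf
    refine ⟨u, w, huw.congr ?_⟩
    filter_upwards [huw.eqn] with t ht
    rw [← ht]; simp
  · intro u w huw
    have h1 := (h _ hf').2 _ _ (huw.exp_smul hp l)
    have h2 : eLpNorm (fun t => Real.exp (-l * (t - c)) • f t) (ENNReal.ofReal p)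
        (volume.restrict (Ioo c d)) ≤ eLpNorm f (ENNReal.ofReal p) (volume.restrict (Ioo c d)) := by
      refine eLpNorm_mono_ae ?_
      filter_upwards [ae_restrict_mem measurableSet_Ioo] with t ht
      rw [norm_smul, Real.norm_of_nonneg (Real.exp_pos _).le]
      refine mul_le_of_le_one_left (norm_nonneg _) (Real.exp_le_one_iff.2 ?_)
      have := mul_nonneg hl (sub_nonneg.2 ht.1.le)
      linarith
    have h3 : eLpNorm u (ENNReal.ofReal p) (volume.restrict (Ioo c d))
        ≤ ENNReal.ofReal (Real.exp (l * (d - c))) *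
          eLpNorm (fun t => Real.exp (-l * (t - c)) • u t) (ENNReal.ofReal p)
            (volume.restrict (Ioo c d)) := by
      refine eLpNorm_le_mul_eLpNorm_of_ae_le_mul ?_ _
      filter_upwards [ae_restrict_mem measurableSet_Ioo] with t ht
      rw [norm_smul, Real.norm_of_nonneg (Real.exp_pos _).le, ← mul_assoc, ← Real.exp_add]
      refine le_mul_of_one_le_left (norm_nonneg _) (Real.one_le_exp ?_)
      have := mul_nonneg hl (sub_nonneg.2 ht.2.le)
      linarith
    rw [mul_assoc]
    exact h3.trans (mul_le_mul_right (h1.trans (mul_le_mul_right h2 _)) _)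

/-- After a shift by l, the two parts of A - A₀ contribute κε ≤ 1/2 and ηM/l ≤ 1/4, so the
contraction principle applies with constant 3/4. The factor 4 comes from that principle and the
exponential from undoing the shift. -/
lemma wellPosed_of_perturbation [CompleteSpace X] {a b ε η κ L : ℝ} {K : ℝ≥0∞} (hp : 1 < p)
    (hι : Function.Injective ι) (hcd : c < d) (hab : d - c ≤ b - a)
    (hA₀ : HasAutMR p ι (Ioi 0) A₀) (hS : IsSemigroupOf ι A₀ S) (hM : ∀ τ, 0 ≤ τ → ‖S τ‖ ≤ M)
    (hK : IsMRBound p ι (Ioo a b) (fun _ => A₀) K)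
    (hKM : K * (1 + ENNReal.ofReal M) ≤ ENNReal.ofReal κ) (hκ : 0 ≤ κ)
    (hε : 0 ≤ ε) (hη : 0 ≤ η) (hκε : κ * ε ≤ 1 / 2)
    (hAm : ∀ x : D, AEStronglyMeasurable (fun t => A t x) (volume.restrict (Ioo c d)))
    (hAL : ∀ᵐ t ∂(volume.restrict (Ioo c d)), ‖A t‖ ≤ L)
    (hB : ∀ t ∈ Ioo c d, ∀ x, ‖A t x - A₀ x‖ ≤ ε * ‖x‖ + η * ‖ι x‖) :
    WellPosed p ι A c d
      (ENNReal.ofReal (4 * κ * Real.exp ((4 * η * M + 1) * (d - c)))) := by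
  have hM0 : 0 ≤ M := (norm_nonneg _).trans (hM 0 le_rfl)
  have hp1 : 1 ≤ ENNReal.ofReal p := ENNReal.one_le_ofReal.2 hp.le
  -- The summand 4ηM gives ηM/l ≤ 1/4; the summand 1 keeps l positive when ηM = 0.
  set l := 4 * η * M + 1 with hl
  have hl0 : 0 < l := by positivity
  have h0 : WellPosed p ι (fun _ => A₀ + l • ι) c d (ENNReal.ofReal κ) := fun g hg =>
    ⟨exists_isMildSol_shift hp.le l (fun f hf => exists_isMildSol_of_hasAutMR hp.le hcd hA₀ hf) hg,
      fun u w h => (eLpNorm_le_of_isMRBound_shift hp hι hcd hab hl0 hA₀ hS hM hK hg h).trans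
        (mul_le_mul_left hKM _)⟩
  have hBm : ∀ u : ℝ → D, MemLp u (ENNReal.ofReal p) (volume.restrict (Ioo c d)) →
      MemLp (fun t => (A t - A₀) (u t)) (ENNReal.ofReal p) (volume.restrict (Ioo c d)) :=
    fun u hu => (memLp_clm_apply hAm hAL hu).sub (memLp_clm A₀ hu)
  have h1 := wellPosed_of_contraction (B := fun t => A t - A₀) hp.le hBm h0 (by
    intro g u w hg h
    have h2 := eLpNorm_perturbation_le (ι := ι) (B := fun t => A t - A₀) hp1 hε hη (by
      filter_upwards [ae_restrict_mem measurableSet_Ioo] with t ht x using hB t ht x) h.memLp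
    have h3 := (h0 g hg).2 u w h
    have h4 := h.resolvent_estimate hp hcd.le hl0 hS hM hg
    refine h2.trans ?_
    set G := eLpNorm g (ENNReal.ofReal p) (volume.restrict (Ioo c d))
    set V := eLpNorm (fun t => ι (u t)) (ENNReal.ofReal p) (volume.restrict (Ioo c d))
    have h5 : ENNReal.ofReal η * V ≤ ENNReal.ofReal (1 / 4) * G := by
      have hηl : η = η / l * l := by field_simp
      calc ENNReal.ofReal η * V = ENNReal.ofReal (η / l) * (ENNReal.ofReal l * V) := by
            rw [← mul_assoc, ← ENNReal.ofReal_mul (by positivity), ← hηl]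
        _ ≤ ENNReal.ofReal (η / l) * (ENNReal.ofReal M * G) := mul_le_mul_right h4 _
        _ = ENNReal.ofReal (η / l * M) * G := by
            rw [← mul_assoc, ← ENNReal.ofReal_mul (by positivity)]
        _ ≤ ENNReal.ofReal (1 / 4) * G := by
            refine mul_le_mul_left (ENNReal.ofReal_le_ofReal ?_) _
            rw [div_mul_eq_mul_div, div_le_iff₀ hl0, hl]
            linarith
    calc _ ≤ ENNReal.ofReal ε * (ENNReal.ofReal κ * G) + ENNReal.ofReal (1 / 4) * G :=
          add_le_add (mul_le_mul_right h3 _) h5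
      _ = ENNReal.ofReal (ε * κ + 1 / 4) * G := by
          rw [← mul_assoc, ← ENNReal.ofReal_mul hε, ← add_mul,
            ← ENNReal.ofReal_add (by positivity) (by positivity)]
      _ ≤ ENNReal.ofReal (3 / 4) * G :=
          mul_le_mul_left (ENNReal.ofReal_le_ofReal (by linarith)) _)
  have e : (fun t => A₀ + l • ι + (A t - A₀)) = fun t => A t + l • ι := by
    funext t; abel
  rw [e] at h1
  have h6 := h1.unshift hp.le hl0.le
  have e2 : ENNReal.ofReal (Real.exp (l * (d - c))) * (ENNReal.ofReal κ * 4)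
      = ENNReal.ofReal (4 * κ * Real.exp (l * (d - c))) := by
    rw [show (4 : ℝ≥0∞) = ENNReal.ofReal 4 by simp, ← ENNReal.ofReal_mul hκ,
      ← ENNReal.ofReal_mul (Real.exp_pos _).le]
    congr 1; ring
  rwa [e2] at h6

end Perturbation

/-! ### Gluing of solutions on adjacent intervals -/

section Gluing

variable {p : ℝ} {ι : D →L[ℝ] X} {A : ℝ → D →L[ℝ] X} {c₀ c d : ℝ}
  {f : ℝ → X} {u : ℝ → D} {w : ℝ → X}

lemma ae_restrict_Ioo_of_adjacent {P : ℝ → Prop}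
    (h1 : ∀ᵐ t ∂(volume.restrict (Ioo c₀ c)), P t) (h2 : ∀ᵐ t ∂(volume.restrict (Ioo c d)), P t) :
    ∀ᵐ t ∂(volume.restrict (Ioo c₀ d)), P t := by
  rw [ae_restrict_iff' measurableSet_Ioo] at *
  have hne : ∀ᵐ t : ℝ, t ≠ c := by simp [ae_iff, measure_singleton]
  filter_upwards [h1, h2, hne] with t h1 h2 hne ht
  rcases lt_or_gt_of_ne hne with h | h
  · exact h1 ⟨ht.1, h⟩
  · exact h2 ⟨h, ht.2⟩

lemma memLp_indicator_Ioo {E : Type*} [NormedAddCommGroup E] {q : ℝ≥0∞} {v : ℝ → E} {S T : Set ℝ}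
    (hS : MeasurableSet S) (hST : S ⊆ T) :
    MemLp (S.indicator v) q (volume.restrict T) ↔ MemLp v q (volume.restrict S) := by
  rw [memLp_indicator_iff_restrict hS, Measure.restrict_restrict hS, inter_eq_left.2 hST]

lemma eLpNorm_indicator_Ioo {E : Type*} [NormedAddCommGroup E] {q : ℝ≥0∞} {v : ℝ → E} {S T : Set ℝ}
    (hS : MeasurableSet S) (hST : S ⊆ T) :
    eLpNorm (S.indicator v) q (volume.restrict T) = eLpNorm v q (volume.restrict S) := by
  rw [eLpNorm_indicator_eq_eLpNorm_restrict hS, Measure.restrict_restrict hS, inter_eq_left.2 hST]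

lemma eLpNorm_Ioo_le_add {E : Type*} [NormedAddCommGroup E] {q : ℝ≥0∞} {v : ℝ → E} (hq : 1 ≤ q)
    (hc : c₀ ≤ c) (hd : c ≤ d) (hv : MemLp v q (volume.restrict (Ioo c₀ d))) :
    eLpNorm v q (volume.restrict (Ioo c₀ d))
      ≤ eLpNorm v q (volume.restrict (Ioo c₀ c)) + eLpNorm v q (volume.restrict (Ioo c d)) := by
  have h1 : Ioo c₀ c ⊆ Ioo c₀ d := Ioo_subset_Ioo_right hd
  have h2 : Ioo c d ⊆ Ioo c₀ d := Ioo_subset_Ioo_left hc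
  rw [← eLpNorm_indicator_Ioo measurableSet_Ioo h1, ← eLpNorm_indicator_Ioo measurableSet_Ioo h2]
  refine le_trans (le_of_eq (eLpNorm_congr_ae ?_))
    (eLpNorm_add_le (hv.1.indicator measurableSet_Ioo) (hv.1.indicator measurableSet_Ioo) hq)
  refine ae_restrict_Ioo_of_adjacent (c := c) ?_ ?_
  · filter_upwards [ae_restrict_mem measurableSet_Ioo] with t ht
    rw [Pi.add_apply, indicator_of_mem ht, indicator_of_notMem fun h => (h.1.trans ht.2).false,
      add_zero]
  · filter_upwards [ae_restrict_mem measurableSet_Ioo] with t ht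
    rw [Pi.add_apply, indicator_of_mem ht, indicator_of_notMem fun h => (h.2.trans ht.1).false,
      zero_add]

lemma eLpNorm_clm_apply_le {q : ℝ≥0∞} {μ : Measure ℝ} {L : ℝ} (hL : ∀ᵐ t ∂μ, ‖A t‖ ≤ L) :
    eLpNorm (fun t => A t (u t)) q μ ≤ ENNReal.ofReal L * eLpNorm u q μ := by
  refine eLpNorm_le_mul_eLpNorm_of_ae_le_mul ?_ q
  filter_upwards [hL] with t ht using (A t).le_of_opNorm_le ht _

/-- A solution is extended beyond the right endpoint `c` by reflection. -/
lemma IsMildSol.exists_reflection (hp : 1 ≤ p) (hc : c₀ ≤ c)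
    (h : IsMildSol p ι c₀ c A f u w) (d : ℝ) :
    ∃ (v : ℝ → D) (z : ℝ → X), MemLp v (ENNReal.ofReal p) (volume.restrict (Ioo c d)) ∧
      MemLp z (ENNReal.ofReal p) (volume.restrict (Ioo c d)) ∧
      eLpNorm v (ENNReal.ofReal p) (volume.restrict (Ioo c d))
        ≤ eLpNorm u (ENNReal.ofReal p) (volume.restrict (Ioo c₀ c)) ∧
      eLpNorm z (ENNReal.ofReal p) (volume.restrict (Ioo c d))
        ≤ eLpNorm w (ENNReal.ofReal p) (volume.restrict (Ioo c₀ c)) ∧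
      ∀ᵐ t ∂(volume.restrict (Ioo c d)), ι (v t) = (∫ s in c₀..c, w s) + ∫ s in c..t, z s := by
  -- Extension by zero to the whole line allows reflection onto an interval longer than (c₀,c).
  set U := (Ioo c₀ c).indicator u with hU
  set W := (Ioo c₀ c).indicator w with hW
  have hmp := Measure.measurePreserving_sub_left (volume : Measure ℝ) (2 * c)
  have hUm : MemLp U (ENNReal.ofReal p) volume := (memLp_indicator_iff_restrict
    measurableSet_Ioo).2 h.memLp
  have hWm : MemLp W (ENNReal.ofReal p) volume := (memLp_indicator_iff_restrict
    measurableSet_Ioo).2 h.memLp_deriv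
  have eU : eLpNorm U (ENNReal.ofReal p) volume
      = eLpNorm u (ENNReal.ofReal p) (volume.restrict (Ioo c₀ c)) :=
    eLpNorm_indicator_eq_eLpNorm_restrict measurableSet_Ioo
  have eW : eLpNorm W (ENNReal.ofReal p) volume
      = eLpNorm w (ENNReal.ofReal p) (volume.restrict (Ioo c₀ c)) :=
    eLpNorm_indicator_eq_eLpNorm_restrict measurableSet_Ioo
  have hWi : Integrable W :=
    (integrable_indicator_iff measurableSet_Ioo).2 (integrableOn_of_memLp hp h.memLp_deriv)
  -- The zero initial value at c₀ is what lets the extended functions keep the primitive relation to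
  -- the left of c₀.
  have hUW : ∀ᵐ s : ℝ, s < c → ι (U s) = ∫ r in c₀..s, W r := by
    filter_upwards [(ae_restrict_iff' measurableSet_Ioo).1 h.integral] with s hs hsc
    rcases lt_or_ge c₀ s with h0 | h0
    · rw [hU, indicator_of_mem (show s ∈ Ioo c₀ c from ⟨h0, hsc⟩), hs ⟨h0, hsc⟩]
      refine intervalIntegral.integral_congr_ae (Eventually.of_forall fun r hr => ?_)
      rw [uIoc_of_le h0.le] at hr
      rw [hW, indicator_of_mem (show r ∈ Ioo c₀ c from ⟨hr.1, hr.2.trans_lt hsc⟩)]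
    · rw [hU, indicator_of_notMem fun h => absurd h.1 (not_lt.2 h0), map_zero]
      refine (intervalIntegral.integral_zero_ae (Eventually.of_forall fun r hr => ?_)).symm
      rw [uIoc_of_ge h0] at hr
      rw [hW, indicator_of_notMem fun h => absurd h.1 (not_lt.2 hr.2)]
  have hWw : ∫ s in c₀..c, w s = ∫ s in c₀..c, W s := by
    have hne : ∀ᵐ s : ℝ, s ≠ c := by simp [ae_iff, measure_singleton]
    refine intervalIntegral.integral_congr_ae ?_
    filter_upwards [hne] with r hrc hr
    rw [uIoc_of_le hc] at hr
    rw [hW, indicator_of_mem (show r ∈ Ioo c₀ c from ⟨hr.1, lt_of_le_of_ne hr.2 hrc⟩)]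
  refine ⟨fun t => U (2 * c - t), fun t => -W (2 * c - t),
    (hUm.comp_measurePreserving hmp).restrict _, (hWm.comp_measurePreserving hmp).neg.restrict _,
    ?_, ?_, ?_⟩
  · refine (eLpNorm_restrict_le _ _ _ _).trans (le_of_eq ?_)
    exact (eLpNorm_comp_measurePreserving hUm.1 hmp).trans eU
  · refine (eLpNorm_restrict_le _ _ _ _).trans (le_of_eq ?_)
    exact (eLpNorm_neg (W ∘ fun t => 2 * c - t) _ _).trans
      ((eLpNorm_comp_measurePreserving hWm.1 hmp).trans eW)
  · filter_upwards [ae_restrict_of_ae (hmp.quasiMeasurePreserving.ae hUW),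
      ae_restrict_mem measurableSet_Ioo] with t ht htI
    rw [ht (by linarith [htI.1]), hWw, intervalIntegral.integral_neg,
      intervalIntegral.integral_comp_sub_left (fun s => W s),
      show 2 * c - c = c by ring, ← intervalIntegral.integral_add_adjacent_intervals
        (hWi.intervalIntegrable (a := c₀) (b := 2 * c - t))
        (hWi.intervalIntegrable (b := c))]
    abel

variable {κ κ' : ℝ≥0∞} {L : ℝ}

lemma WellPosed.mono (h : WellPosed p ι A c d κ) (hκ : κ ≤ κ') : WellPosed p ι A c d κ' :=
  fun f hf => ⟨(h f hf).1, fun u w huw => ((h f hf).2 u w huw).trans (mul_le_mul_left hκ _)⟩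

lemma IsMildSol.eLpNorm_deriv_le (hp : 1 ≤ p)
    (hAm : ∀ x : D, AEStronglyMeasurable (fun t => A t x) (volume.restrict (Ioo c d)))
    (hAL : ∀ᵐ t ∂(volume.restrict (Ioo c d)), ‖A t‖ ≤ L)
    (hf : MemLp f (ENNReal.ofReal p) (volume.restrict (Ioo c d)))
    (h : IsMildSol p ι c d A f u w) :
    eLpNorm w (ENNReal.ofReal p) (volume.restrict (Ioo c d))
      ≤ eLpNorm f (ENNReal.ofReal p) (volume.restrict (Ioo c d)) + ENNReal.ofReal L *
        eLpNorm u (ENNReal.ofReal p) (volume.restrict (Ioo c d)) := by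
  have e : w =ᵐ[volume.restrict (Ioo c d)] fun t => f t - A t (u t) := by
    filter_upwards [h.eqn] with t ht
    rw [← ht]; abel
  rw [eLpNorm_congr_ae e]
  exact (eLpNorm_sub_le hf.1 (memLp_clm_apply hAm hAL h.memLp).1
    (ENNReal.one_le_ofReal.2 hp)).trans (add_le_add le_rfl (eLpNorm_clm_apply_le hAL))

/-- On (c,d) the difference between u and the reflection v of its first piece starts from zero and
has data f - z - Av, where z is the derivative of v. Here v costs at most κ‖f‖ and z at most (1 +
Lκ)‖f‖. The term 2κ collects u on the first piece and v on the second; the rest is κ' times the norm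
of the new data. -/
lemma WellPosed.glue [CompleteSpace X] (hp : 1 ≤ p) (hc : c₀ < c) (hd : c < d)
    (hAm : ∀ x : D, AEStronglyMeasurable (fun t => A t x) (volume.restrict (Ioo c₀ d)))
    (hAL : ∀ᵐ t ∂(volume.restrict (Ioo c₀ d)), ‖A t‖ ≤ L)
    (h1 : WellPosed p ι A c₀ c κ) (h2 : WellPosed p ι A c d κ') :
    WellPosed p ι A c₀ d (2 * κ + κ' * (2 + 2 * ENNReal.ofReal L * κ)) := by
  intro f hf
  have hp1 : 1 ≤ ENNReal.ofReal p := ENNReal.one_le_ofReal.2 hp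
  have hs1 : Ioo c₀ c ⊆ Ioo c₀ d := Ioo_subset_Ioo_right hd.le
  have hs2 : Ioo c d ⊆ Ioo c₀ d := Ioo_subset_Ioo_left hc.le
  have hm1 : volume.restrict (Ioo c₀ c) ≤ volume.restrict (Ioo c₀ d) :=
    Measure.restrict_mono hs1 le_rfl
  have hm2 : volume.restrict (Ioo c d) ≤ volume.restrict (Ioo c₀ d) :=
    Measure.restrict_mono hs2 le_rfl
  have hf1 := hf.mono_measure hm1
  have hf2 := hf.mono_measure hm2
  have hAm1 := fun x => (hAm x).mono_measure hm1
  have hAm2 := fun x => (hAm x).mono_measure hm2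
  have hAL1 := ae_mono hm1 hAL
  have hAL2 := ae_mono hm2 hAL
  constructor
  · obtain ⟨u₁, w₁, hu₁⟩ := (h1 f hf1).1
    obtain ⟨v, z, hv, hz, -, -, hvz⟩ := hu₁.exists_reflection hp hc.le d
    have hg : MemLp (fun t => f t - z t - A t (v t)) (ENNReal.ofReal p)
        (volume.restrict (Ioo c d)) := (hf2.sub hz).sub (memLp_clm_apply hAm2 hAL2 hv)
    obtain ⟨u₂, w₂, hu₂⟩ := (h2 _ hg).1
    set u := fun t => (Ioo c₀ c).indicator u₁ t + (Ioo c d).indicator (fun t => u₂ t + v t) t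
      with hu
    set w := fun t => (Ioo c₀ c).indicator w₁ t + (Ioo c d).indicator (fun t => w₂ t + z t) t
      with hw
    have e1 : ∀ t ∈ Ioo c₀ c, u t = u₁ t ∧ w t = w₁ t := fun t ht => by
      have : t ∉ Ioo c d := fun h => (h.1.trans ht.2).false
      simp [hu, hw, ht, this]
    have e2 : ∀ t ∈ Ioo c d, u t = u₂ t + v t ∧ w t = w₂ t + z t := fun t ht => by
      have : t ∉ Ioo c₀ c := fun h => (h.2.trans ht.1).false
      simp [hu, hw, ht, this]
    have hwm : MemLp w (ENNReal.ofReal p) (volume.restrict (Ioo c₀ d)) :=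
      ((memLp_indicator_Ioo measurableSet_Ioo hs1).2 hu₁.memLp_deriv).add
        ((memLp_indicator_Ioo measurableSet_Ioo hs2).2 (hu₂.memLp_deriv.add hz))
    have hne : ∀ᵐ s : ℝ, s ≠ c := by simp [ae_iff, measure_singleton]
    have hI1 : ∀ t, c₀ < t → t ≤ c → ∫ s in c₀..t, w s = ∫ s in c₀..t, w₁ s := by
      intro t h0 h1
      refine intervalIntegral.integral_congr_ae ?_
      filter_upwards [hne] with s hs hsI
      rw [uIoc_of_le h0.le] at hsI
      exact (e1 s ⟨hsI.1, lt_of_le_of_ne (hsI.2.trans h1) hs⟩).2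
    have hii : ∀ {g : ℝ → X} {e e' t}, MemLp g (ENNReal.ofReal p) (volume.restrict (Ioo e e')) →
        t ∈ Ioo e e' → IntervalIntegrable g volume e t := by
      intro g e e' t hg ht
      have hee := (ht.1.trans ht.2).le
      refine (intervalIntegrable_of_memLp hp hee hg).mono_set ?_
      rw [uIcc_of_le hee, uIcc_of_le ht.1.le]
      exact Icc_subset_Icc_right ht.2.le
    refine ⟨u, w, ⟨((memLp_indicator_Ioo measurableSet_Ioo hs1).2 hu₁.memLp).add
      ((memLp_indicator_Ioo measurableSet_Ioo hs2).2 (hu₂.memLp.add hv)), hwm, ?_, ?_⟩⟩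
    · refine ae_restrict_Ioo_of_adjacent (c := c) ?_ ?_
      · filter_upwards [hu₁.eqn, ae_restrict_mem measurableSet_Ioo] with t ht htI
        rw [(e1 t htI).1, (e1 t htI).2, ht]
      · filter_upwards [hu₂.eqn, ae_restrict_mem measurableSet_Ioo] with t ht htI
        rw [(e2 t htI).1, (e2 t htI).2, map_add, add_add_add_comm, ht]
        abel
    · refine ae_restrict_Ioo_of_adjacent (c := c) ?_ ?_
      · filter_upwards [hu₁.integral, ae_restrict_mem measurableSet_Ioo] with t ht htI
        rw [(e1 t htI).1, ht, hI1 t htI.1 htI.2.le]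
      · filter_upwards [hu₂.integral, hvz, ae_restrict_mem measurableSet_Ioo] with t ht ht' htI
        have hw2 : ∫ s in c..t, w s = ∫ s in c..t, (w₂ s + z s) := by
          refine intervalIntegral.integral_congr_ae (Eventually.of_forall fun s hsI => ?_)
          rw [uIoc_of_le htI.1.le] at hsI
          exact (e2 s ⟨hsI.1, hsI.2.trans_lt htI.2⟩).2
        have hwc : IntervalIntegrable w volume c₀ c := hii hwm ⟨hc, hd⟩
        have hwt : IntervalIntegrable w volume c₀ t := hii hwm ⟨hc.trans htI.1, htI.2⟩
        rw [(e2 t htI).1, map_add, ht, ht',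
          ← intervalIntegral.integral_add_adjacent_intervals hwc (hwc.symm.trans hwt),
          hI1 c hc le_rfl, hw2,
          intervalIntegral.integral_add (hii hu₂.memLp_deriv htI) (hii hz htI)]
        abel
  · intro u w h
    have hu1 := h.mono hd.le
    obtain ⟨v, z, hv, hz, hvn, hzn, hvz⟩ := hu1.exists_reflection hp hc.le d
    have hAv := memLp_clm_apply hAm2 hAL2 hv
    have hg : MemLp (fun t => f t - z t - A t (v t)) (ENNReal.ofReal p)
        (volume.restrict (Ioo c d)) := (hf2.sub hz).sub hAv
    have hu2m := h.memLp.mono_measure hm2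
    have hw2m := h.memLp_deriv.mono_measure hm2
    have hsol : IsMildSol p ι c d A (fun t => f t - z t - A t (v t)) (fun t => u t - v t)
        (fun t => w t - z t) := by
      refine ⟨hu2m.sub hv, hw2m.sub hz, ?_, ?_⟩
      · filter_upwards [ae_mono hm2 h.eqn] with t ht
        rw [map_sub, ← ht]; abel
      · filter_upwards [ae_mono hm2 h.integral, hvz, ae_restrict_mem measurableSet_Ioo]
          with t ht ht' htI
        have hcd' : uIcc c t ⊆ uIcc c d := by
          rw [uIcc_of_le hd.le, uIcc_of_le htI.1.le]; exact Icc_subset_Icc_right htI.2.le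
        have hwt := (intervalIntegrable_of_memLp hp hd.le hw2m).mono_set hcd'
        have hzt := (intervalIntegrable_of_memLp hp hd.le hz).mono_set hcd'
        have hwc : IntervalIntegrable w volume c₀ c :=
          intervalIntegrable_of_memLp hp hc.le hu1.memLp_deriv
        rw [map_sub, ht, ht', intervalIntegral.integral_sub hwt hzt,
          ← intervalIntegral.integral_add_adjacent_intervals hwc hwt]
        abel
    have hb1 := (h1 f hf1).2 u w hu1
    have hb2 := (h2 _ hg).2 _ _ hsol
    have hb3 := hu1.eLpNorm_deriv_le hp hAm1 hAL1 hf1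
    have hfn1 : eLpNorm f (ENNReal.ofReal p) (volume.restrict (Ioo c₀ c))
        ≤ eLpNorm f (ENNReal.ofReal p) (volume.restrict (Ioo c₀ d)) := eLpNorm_mono_measure _ hm1
    have hfn2 : eLpNorm f (ENNReal.ofReal p) (volume.restrict (Ioo c d))
        ≤ eLpNorm f (ENNReal.ofReal p) (volume.restrict (Ioo c₀ d)) := eLpNorm_mono_measure _ hm2
    have hb4 : eLpNorm (fun t => f t - z t - A t (v t)) (ENNReal.ofReal p)
        (volume.restrict (Ioo c d)) ≤ eLpNorm f (ENNReal.ofReal p) (volume.restrict (Ioo c d))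
          + eLpNorm z (ENNReal.ofReal p) (volume.restrict (Ioo c d))
          + ENNReal.ofReal L * eLpNorm v (ENNReal.ofReal p) (volume.restrict (Ioo c d)) :=
      (eLpNorm_sub_le (hf2.sub hz).1 hAv.1 hp1).trans
        (add_le_add (eLpNorm_sub_le hf2.1 hz.1 hp1) (eLpNorm_clm_apply_le hAL2))
    have hb5 : eLpNorm u (ENNReal.ofReal p) (volume.restrict (Ioo c d))
        ≤ eLpNorm (fun t => u t - v t) (ENNReal.ofReal p) (volume.restrict (Ioo c d))
          + eLpNorm v (ENNReal.ofReal p) (volume.restrict (Ioo c d)) := by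
      have := eLpNorm_add_le (hu2m.sub hv).1 hv.1 hp1
      rwa [sub_add_cancel] at this
    have hb6 := eLpNorm_Ioo_le_add hp1 hc.le hd.le h.memLp
    set F := eLpNorm f (ENNReal.ofReal p) (volume.restrict (Ioo c₀ d))
    set U := eLpNorm u (ENNReal.ofReal p) (volume.restrict (Ioo c₀ c))
    set V := eLpNorm v (ENNReal.ofReal p) (volume.restrict (Ioo c d))
    set Λ := ENNReal.ofReal L
    have hU : U ≤ κ * F := hb1.trans (mul_le_mul_right hfn1 _)
    have hV : V ≤ κ * F := hvn.trans hU
    calc eLpNorm u (ENNReal.ofReal p) (volume.restrict (Ioo c₀ d))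
        ≤ U + (κ' * (F + (F + Λ * U) + Λ * V) + V) := by
          refine hb6.trans (add_le_add le_rfl (hb5.trans (add_le_add (hb2.trans ?_) le_rfl)))
          refine mul_le_mul_right (hb4.trans ?_) _
          exact add_le_add (add_le_add hfn2 (hzn.trans (hb3.trans (add_le_add hfn1 le_rfl)))) le_rfl
      _ ≤ κ * F + (κ' * (F + (F + Λ * (κ * F)) + Λ * (κ * F)) + κ * F) := by gcongr
      _ = (2 * κ + κ' * (2 + 2 * Λ * κ)) * F := by ring

lemma WellPosed.iterate [CompleteSpace X] {a ℓ : ℝ} {N : ℕ} (hp : 1 ≤ p) (hℓ : 0 < ℓ) (hN : 0 < N)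
    (hAm : ∀ x : D, AEStronglyMeasurable (fun t => A t x) (volume.restrict (Ioo a (a + N * ℓ))))
    (hAL : ∀ᵐ t ∂(volume.restrict (Ioo a (a + N * ℓ))), ‖A t‖ ≤ L)
    (h : ∀ k : ℕ, k < N → WellPosed p ι A (a + k * ℓ) (a + (k + 1) * ℓ) κ) :
    WellPosed p ι A a (a + N * ℓ) ((2 + κ * (2 + 2 * ENNReal.ofReal L)) ^ N) := by
  -- If Q ≥ 1 bounds the glued part, the next gluing gives 2Q + κ(2 + 2LQ) ≤ Qq.
  set q := 2 + κ * (2 + 2 * ENNReal.ofReal L) with hq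
  have hq1 : 1 ≤ q := le_trans (by norm_num) (le_self_add : (2 : ℝ≥0∞) ≤ q)
  have key : ∀ k : ℕ, k < N → WellPosed p ι A a (a + (k + 1) * ℓ) (q ^ (k + 1)) := by
    intro k
    induction k with
    | zero =>
      intro h0
      have := h 0 h0
      simp only [Nat.cast_zero, zero_mul, add_zero, zero_add, pow_one] at this ⊢
      refine this.mono ?_
      calc κ = κ * 1 := (mul_one _).symm
        _ ≤ κ * (2 + 2 * ENNReal.ofReal L) :=
          mul_le_mul_right (le_trans (by norm_num) (le_self_add : (2 : ℝ≥0∞) ≤ _)) _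
        _ ≤ q := le_add_self
    | succ k ih =>
      intro hk
      have h1 := ih (by omega)
      have h2 := h (k + 1) hk
      push_cast at h2 ⊢
      have hle : a + ((k : ℝ) + 1 + 1) * ℓ ≤ a + N * ℓ := by
        have : ((k + 1 + 1 : ℕ) : ℝ) ≤ N := by exact_mod_cast hk
        push_cast at this
        nlinarith
      have hm : volume.restrict (Ioo a (a + ((k : ℝ) + 1 + 1) * ℓ))
          ≤ volume.restrict (Ioo a (a + N * ℓ)) :=
        Measure.restrict_mono (Ioo_subset_Ioo_right hle) le_rfl
      have hpos : a < a + ((k : ℝ) + 1) * ℓ := by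
        have : 0 < ((k : ℝ) + 1) * ℓ := by positivity
        linarith
      refine (h1.glue hp hpos (by nlinarith) (fun x => (hAm x).mono_measure hm)
        (ae_mono hm hAL) h2).mono ?_
      have hQ : 1 ≤ q ^ (k + 1) := one_le_pow₀ hq1
      set Q := q ^ (k + 1)
      calc 2 * Q + κ * (2 + 2 * ENNReal.ofReal L * Q)
          ≤ 2 * Q + κ * (2 * Q + 2 * ENNReal.ofReal L * Q) := by
            gcongr
            exact le_mul_of_one_le_right (zero_le) hQ
        _ = Q * q := by rw [hq]; ring
        _ = q ^ (k + 1 + 1) := (pow_succ _ _).symm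
  obtain ⟨k, rfl⟩ : ∃ k, N = k + 1 := ⟨N - 1, by omega⟩
  have := key k (Nat.lt_succ_self k)
  push_cast
  exact this

end Gluing

/-! ### Elementary estimates for the constants -/

section Numerics

lemma one_lt_rStar {r : ℝ} (hr : 1 < r) : 1 < rStar r := by
  unfold rStar
  rw [lt_div_iff₀ (by linarith)]
  linarith

lemma rStar_mul_sub_one {r : ℝ} (hr : 1 < r) : rStar r * (r - 1) = r := by
  unfold rStar
  exact div_mul_cancel₀ _ (by linarith)

/-- Raise the hypothesis to the power r - 1, using r*(r-1) = r. It becomes the comparison of an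
integral with length times threshold that Chebyshev's inequality needs. -/
lemma rpow_lt_of_lt_inv {G r α mδ ℓ : ℝ} (hr : 1 < r) (hG : 0 ≤ G) (hmδ : 0 < mδ) (hℓ : 0 < ℓ)
    (h : (2 ^ α * (G / mδ)) ^ rStar r < ℓ⁻¹) : G ^ r < (mδ / (2 ^ α * ℓ)) ^ r * ℓ := by
  have h2 : (0 : ℝ) < 2 ^ α := by positivity
  have hy : 0 ≤ 2 ^ α * (G / mδ) := by positivity
  have h1 := Real.rpow_lt_rpow (by positivity) h (by linarith : 0 < r - 1)
  rw [← Real.rpow_mul hy, rStar_mul_sub_one hr] at h1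
  have e1 : G = mδ / 2 ^ α * (2 ^ α * (G / mδ)) := by field_simp
  have e2 : (mδ / (2 ^ α * ℓ)) ^ r * ℓ = (mδ / 2 ^ α) ^ r * ℓ⁻¹ ^ (r - 1) := by
    rw [show mδ / (2 ^ α * ℓ) = mδ / 2 ^ α * ℓ⁻¹ by field_simp,
      Real.mul_rpow (by positivity) (by positivity), Real.rpow_sub (by positivity), Real.rpow_one]
    field_simp
  rw [e2]
  conv_lhs => rw [e1]
  rw [Real.mul_rpow (by positivity) hy]
  exact mul_lt_mul_of_pos_left h1 (by positivity)

/-- With q = (β+1)/α one has r*q = r* + s₁, so the powers of G agree. The exponent of m_δ on the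
left exceeds the one on the right by 1/(α+1), which is harmless for m_δ ≤ 1. -/
lemma rpow_mul_rpow_le {G r α β mδ : ℝ} (hr : 1 < r) (hα : 1 ≤ α) (hG : 0 < G) (hmδ : 0 < mδ) (hmδ1 : mδ ≤ 1) :
    mδ ^ ((β + 1) / α) * ((G / mδ) ^ rStar r) ^ ((β + 1) / α)
      ≤ (G / mδ) ^ rStar r * (mδ ^ s₂ α β r * G ^ s₁ α β r) := by
  have hα0 : α ≠ 0 := by positivity
  have hα1 : α + 1 ≠ 0 := by positivity
  set q := (β + 1) / α with hq
  have hs1 : rStar r * q = rStar r + s₁ α β r := by unfold s₁; ring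
  rw [← Real.rpow_mul (by positivity), Real.div_rpow hG.le hmδ.le, Real.div_rpow hG.le hmδ.le, hs1,
    Real.rpow_add hG]
  have hs2 : q - (rStar r + s₁ α β r) ≥ s₂ α β r - rStar r := by
    have hr1 : r - 1 ≠ 0 := by linarith
    have hr0 : r ≠ 0 := by linarith
    have e : q - (rStar r + s₁ α β r) - (s₂ α β r - rStar r) = 1 / (α + 1) := by
      rw [hq]
      unfold s₂ s₁ rStar
      field_simp
      ring
    have : 0 < 1 / (α + 1) := by positivity
    linarith
  have h1 : mδ ^ (q - (rStar r + s₁ α β r)) ≤ mδ ^ (s₂ α β r - rStar r) :=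
    Real.rpow_le_rpow_of_exponent_ge hmδ hmδ1 hs2
  rw [Real.rpow_sub hmδ, Real.rpow_sub hmδ] at h1
  calc _ = G ^ rStar r * G ^ s₁ α β r * (mδ ^ q / mδ ^ (rStar r + s₁ α β r)) := by ring
    _ ≤ G ^ rStar r * G ^ s₁ α β r * (mδ ^ s₂ α β r / mδ ^ rStar r) := by gcongr
    _ = _ := by ring

/-- For x < 1 the logarithm in the stated bound is negative. With y = x^{r*}, the inequality y log y
≥ y - 1 shows that replacing the logarithm by its positive part costs at most the factor r. -/
lemma bracket_le_mul_bracket {r x Q m : ℝ} (hr : 1 < r) (hx : 0 < x) (hQ : 0 ≤ Q) (hm : 0 ≤ m) :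
    x ^ rStar r * (1 + Q + max 0 (Real.log x)) + m + 1
      ≤ r * (x ^ rStar r * (1 + Q + Real.log x) + m + 1) := by
  have hy0 : 0 < x ^ rStar r := by positivity
  have hlogy : Real.log (x ^ rStar r) = rStar r * Real.log x := Real.log_rpow hx _
  set y := x ^ rStar r
  rcases le_total 0 (Real.log x) with h | h
  · rw [max_eq_right h]
    exact le_mul_of_one_le_left (by positivity) hr.le
  · have h1 : 1 - y⁻¹ ≤ Real.log y := Real.one_sub_inv_le_log_of_pos hy0
    have h2 : y - 1 ≤ rStar r * (y * Real.log x) := by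
      have := mul_le_mul_of_nonneg_left h1 hy0.le
      rw [mul_sub, mul_inv_cancel₀ hy0.ne', hlogy] at this
      linarith
    have h3 : (r - 1) * (y - 1) ≤ r * (y * Real.log x) := by
      calc _ ≤ _ := mul_le_mul_of_nonneg_left h2 (by linarith : 0 ≤ r - 1)
        _ = rStar r * (r - 1) * (y * Real.log x) := by ring
        _ = _ := by rw [rStar_mul_sub_one hr]
    have h4 := mul_nonneg (by linarith : 0 ≤ r - 1) (mul_nonneg hy0.le hQ)
    have h5 := mul_nonneg (by linarith : 0 ≤ r - 1) hm
    have h6 := mul_nonneg (by linarith : 0 ≤ r - 1) hy0.le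
    rw [max_eq_left h]
    linarith

/-- The number of cells is at most 1 + c₁y with y = (G/m_δ)^{r*}. Then N log z yields y and y
log⁺(G/m_δ), while z^{β+1} = (z^α)^{(β+1)/α} yields the terms with m_η. Every resulting term is one
of the nonnegative summands of R', the bracket with log⁺. -/
lemma exists_const_log_bound (T L r α β : ℝ) (hT : 0 < T) (hL : 0 ≤ L) (hr : 1 < r) (hα : 1 ≤ α)
    (hβ : 0 ≤ β) :
    ∃ C : ℝ, ∀ (mδ mη G z : ℝ) (N : ℕ), 0 < mδ → mδ ≤ 1 → 0 ≤ mη → 0 < G →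
      (N : ℝ) ≤ T * (2 ^ α * (G / mδ)) ^ rStar r + 1 → 1 ≤ z → z ^ α = mδ * N / T →
      Real.log (1 + 2 * T * (1 + L)) + N * (Real.log z + Real.log (2 * (3 + 2 * L)))
          + T * (4 * mη * z ^ (β + 1) + 1)
        ≤ C * ((G / mδ) ^ rStar r *
            (1 + mη * mδ ^ s₂ α β r * G ^ s₁ α β r + Real.log (G / mδ)) + mη + 1) := by
  set c₁ : ℝ := T * (2 ^ α) ^ rStar r with hc₁
  have hc₁0 : 0 < c₁ := by positivity
  set q := (β + 1) / α with hq
  have hα0 : 0 < α := by linarith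
  have hq0 : 0 < q := by positivity
  set c₂ : ℝ := |Real.log ((1 + c₁) / T)| with hc₂
  have hc₂0 : 0 ≤ c₂ := abs_nonneg _
  set c₀ : ℝ := Real.log (1 + 2 * T * (1 + L)) with hc₀
  have hc₀0 : 0 ≤ c₀ := Real.log_nonneg (by nlinarith [mul_nonneg hT.le hL])
  set c₃ : ℝ := Real.log (2 * (3 + 2 * L)) with hc₃
  have hc₃0 : 0 ≤ c₃ := Real.log_nonneg (by linarith)
  set c₄ : ℝ := 4 * T * 2 ^ q * (1 / T) ^ q with hc₄
  have hc₄0 : 0 ≤ c₄ := by positivity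
  set c₅ : ℝ := 4 * T * 2 ^ q * (c₁ / T) ^ q with hc₅
  have hc₅0 : 0 ≤ c₅ := by positivity
  have hrs : 1 < rStar r := one_lt_rStar hr
  refine ⟨(c₀ + c₃ * (1 + c₁) + c₂ + c₁ * c₂ + 1 + c₁ * rStar r + T + c₄ + c₅) * r, ?_⟩
  intro mδ mη G z N hmδ hmδ1 hmη hG hN hz hzN
  set x := G / mδ with hx
  have hx0 : 0 < x := by positivity
  set y := x ^ rStar r with hy
  have hy0 : 0 < y := by positivity
  have hlogy : Real.log y = rStar r * Real.log x := Real.log_rpow hx0 _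
  set Q := mη * mδ ^ s₂ α β r * G ^ s₁ α β r with hQ
  have hQ0 : 0 ≤ Q := by positivity
  set P := max 0 (Real.log x) with hP
  have hP0 : 0 ≤ P := le_max_left _ _
  have hN1 : (N : ℝ) ≤ 1 + c₁ * y := by
    rw [Real.mul_rpow (by positivity) hx0.le] at hN
    rw [hc₁, hy]; linarith
  have hN0 : (0 : ℝ) < N := by
    have h1 : 0 < z ^ α := by positivity
    rw [hzN] at h1
    by_contra h
    have h2 : (N : ℝ) = 0 := le_antisymm (not_lt.1 h) (Nat.cast_nonneg _)
    rw [h2] at h1; simp at h1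
  -- From log y ≤ y - 1; this absorbs the logarithm that is not multiplied by y.
  have hPy : rStar r * P ≤ y := by
    rcases le_total (Real.log x) 0 with h | h
    · rw [hP, max_eq_left h, mul_zero]; exact hy0.le
    · rw [hP, max_eq_right h, ← hlogy]
      exact (Real.log_le_sub_one_of_pos hy0).trans (by linarith)
  have hymax : 1 + c₁ * y ≤ (1 + c₁) * Real.exp (rStar r * P) := by
    have h1 : 1 ≤ Real.exp (rStar r * P) := Real.one_le_exp (by positivity)
    have h2 : y ≤ Real.exp (rStar r * P) := by
      rw [← Real.exp_log hy0, hlogy]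
      exact Real.exp_le_exp.2 (mul_le_mul_of_nonneg_left (le_max_right _ _) (by linarith))
    nlinarith
  have hlogz : Real.log z ≤ c₂ + rStar r * P := by
    have h0 : 0 ≤ Real.log z := Real.log_nonneg hz
    calc Real.log z ≤ α * Real.log z := le_mul_of_one_le_left h0 hα
      _ = Real.log (mδ * N / T) := by rw [← hzN, Real.log_rpow (by linarith)]
      _ ≤ Real.log ((1 + c₁) / T * Real.exp (rStar r * P)) := by
        refine Real.log_le_log (by positivity) ?_
        rw [div_mul_eq_mul_div]
        refine div_le_div_of_nonneg_right (le_trans ?_ (hN1.trans hymax)) hT.le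
        exact mul_le_of_le_one_left hN0.le hmδ1
      _ = Real.log ((1 + c₁) / T) + rStar r * P := by
        rw [Real.log_mul (by positivity) (Real.exp_pos _).ne', Real.log_exp]
      _ ≤ c₂ + rStar r * P := by gcongr; exact le_abs_self _
  have hNz : N * Real.log z ≤ c₂ + y + c₁ * c₂ * y + c₁ * rStar r * (y * P) := by
    calc N * Real.log z ≤ (1 + c₁ * y) * (c₂ + rStar r * P) :=
          mul_le_mul hN1 hlogz (Real.log_nonneg hz) (by positivity)
      _ = c₂ + rStar r * P + c₁ * c₂ * y + c₁ * rStar r * (y * P) := by ring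
      _ ≤ _ := by gcongr
  have hzq : z ^ (β + 1) = (mδ * N / T) ^ q := by
    rw [← hzN, ← Real.rpow_mul (by linarith), hq, mul_div_cancel₀ _ hα0.ne']
  have hzpow : z ^ (β + 1) ≤ 2 ^ q * ((1 / T) ^ q + (c₁ / T) ^ q * (mδ ^ q * y ^ q)) := by
    rw [hzq]
    have h1 : mδ * N / T ≤ 1 / T + c₁ / T * (mδ * y) := by
      have : mδ * N ≤ mδ * (1 + c₁ * y) := mul_le_mul_of_nonneg_left hN1 hmδ.le
      calc mδ * N / T ≤ (1 + c₁ * (mδ * y)) / T := by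
            refine div_le_div_of_nonneg_right ?_ hT.le
            linarith
        _ = _ := by ring
    -- Bounding the sum by twice the maximum gives the quasi-triangle inequality for the power q,
    -- with constant 2^q, whether or not q ≥ 1.
    have h2 : mδ * N / T ≤ 2 * max (1 / T) (c₁ / T * (mδ * y)) := by
      have := le_max_left (1 / T) (c₁ / T * (mδ * y))
      have := le_max_right (1 / T) (c₁ / T * (mδ * y))
      linarith
    have h3 : 0 ≤ max (1 / T) (c₁ / T * (mδ * y)) := le_max_of_le_left (by positivity)
    refine (Real.rpow_le_rpow (by positivity) h2 hq0.le).trans ?_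
    rw [Real.mul_rpow (by norm_num) h3]
    refine mul_le_mul_of_nonneg_left ?_ (by positivity)
    have e : (c₁ / T * (mδ * y)) ^ q = (c₁ / T) ^ q * (mδ ^ q * y ^ q) := by
      rw [Real.mul_rpow (by positivity) (by positivity), Real.mul_rpow hmδ.le hy0.le]
    rw [← e]
    rcases max_choice (1 / T) (c₁ / T * (mδ * y)) with h | h <;> rw [h]
    · exact le_add_of_nonneg_right (by positivity)
    · exact le_add_of_nonneg_left (by positivity)
  have hkey : mδ ^ q * y ^ q ≤ y * (mδ ^ s₂ α β r * G ^ s₁ α β r) :=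
    rpow_mul_rpow_le hr hα hG hmδ hmδ1
  have hηz : 4 * T * mη * z ^ (β + 1) ≤ c₄ * mη + c₅ * (y * Q) := by
    calc 4 * T * mη * z ^ (β + 1)
        ≤ 4 * T * mη * (2 ^ q * ((1 / T) ^ q + (c₁ / T) ^ q *
            (y * (mδ ^ s₂ α β r * G ^ s₁ α β r)))) := by
          refine mul_le_mul_of_nonneg_left (hzpow.trans ?_) (by positivity)
          gcongr
      _ = c₄ * mη + c₅ * (y * Q) := by rw [hc₄, hc₅, hQ]; ring
  set R' := y * (1 + Q + P) + mη + 1 with hR'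
  have hyQ : 0 ≤ y * Q := by positivity
  have hyP : 0 ≤ y * P := by positivity
  have hR'e : R' = y + y * Q + y * P + mη + 1 := by rw [hR']; ring
  have hmain : c₀ + N * (Real.log z + c₃) + T * (4 * mη * z ^ (β + 1) + 1)
      ≤ (c₀ + c₃ * (1 + c₁) + c₂ + c₁ * c₂ + 1 + c₁ * rStar r + T + c₄ + c₅) * R' := by
    have h3 : N * c₃ ≤ (1 + c₁ * y) * c₃ := mul_le_mul_of_nonneg_right hN1 hc₃0
    have hc : ∀ {c s : ℝ}, 0 ≤ c → s ≤ R' → c * s ≤ c * R' := fun hc hs =>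
      mul_le_mul_of_nonneg_left hs hc
    have hone : 1 ≤ R' := by rw [hR'e]; linarith
    have hyR : y ≤ R' := by rw [hR'e]; linarith
    have g1 := hc hc₀0 hone
    have g2 := hc hc₃0 hone
    have g3 := hc (mul_nonneg hc₃0 hc₁0.le) hyR
    have g4 := hc hc₂0 hone
    have g5 := hc (mul_nonneg hc₁0.le hc₂0) hyR
    have g6 := hc (mul_nonneg hc₁0.le (by linarith : 0 ≤ rStar r))
      (show y * P ≤ R' by rw [hR'e]; linarith)
    have g7 := hc hT.le hone
    have g8 := hc hc₄0 (show mη ≤ R' by rw [hR'e]; linarith)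
    have g9 := hc hc₅0 (show y * Q ≤ R' by rw [hR'e]; linarith)
    linarith
  have hRR : R' ≤ r * (y * (1 + Q + Real.log x) + mη + 1) :=
    bracket_le_mul_bracket hr hx0 hQ0 hmη
  refine hmain.trans ?_
  exact (mul_le_mul_of_nonneg_left hRR (by positivity)).trans_eq (mul_assoc _ _ _).symm

end Numerics

/-! ### Consequences of the assumptions -/

section Assumptions

variable {p : ℝ} {ι : D →L[ℝ] X} {a b c d : ℝ} {A A₀ : ℝ → D →L[ℝ] X} {B : ℝ → ℝ → D →L[ℝ] X}
  {δ η : ℝ → ℝ}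

/-- The infimum is attained: for nonzero ‖f‖ divide by it and pass to the infimum, and for ‖f‖ = 0
any admissible constant gives the claim. -/
lemma isMRBound_mrConst {I : Set ℝ} (h : mrConst p ι I A ≠ ⊤) :
    IsMRBound p ι I A (mrConst p ι I A) := by
  intro f u w hf hu
  obtain ⟨K, hK, -⟩ := sInf_lt_iff.1 (lt_top_iff_ne_top.2 h)
  by_cases h0 : eLpNorm f (ENNReal.ofReal p) (volume.restrict I) = 0
  · have := hK f u w hf hu
    rwa [h0, mul_zero] at this ⊢
  · rw [← ENNReal.div_le_iff h0 hf.2.ne]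
    exact le_sInf fun K hK => (ENNReal.div_le_iff h0 hf.2.ne).2 (hK f u w hf hu)

/-- The strict inequality avoids having to show that the infimum over semigroups is attained. -/
lemma exists_semigroup_of_semigroupBound_lt {A₁ : D →L[ℝ] X} {M : ℝ}
    (h : semigroupBound ι A₁ < ENNReal.ofReal M) :
    ∃ S : ℝ → X →L[ℝ] X, IsSemigroupOf ι A₁ S ∧ ∀ τ, 0 ≤ τ → ‖S τ‖ ≤ M := by
  have hM : 0 < M := by
    by_contra hM
    rw [ENNReal.ofReal_of_nonpos (not_lt.1 hM)] at h
    exact not_lt_zero h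
  unfold semigroupBound at h
  obtain ⟨S, hS⟩ := iInf_lt_iff.1 h
  obtain ⟨hS, hlt⟩ := iInf_lt_iff.1 hS
  refine ⟨S, hS, fun τ hτ => ?_⟩
  have h1 : ‖S τ‖ₑ ≤ ENNReal.ofReal M :=
    (le_iSup₂ (f := fun (τ : ℝ) (_ : 0 ≤ τ) => ‖S τ‖ₑ) τ hτ).trans hlt.le
  rwa [← ofReal_norm, ENNReal.ofReal_le_ofReal_iff hM.le] at h1

/-- The function `(K₀ + 1) (M₀ + 1)`. -/
def mrProd (p : ℝ) (ι : D →L[ℝ] X) (a b : ℝ) (A₀ : ℝ → D →L[ℝ] X) (t : ℝ) : ℝ≥0∞ :=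
  (K₀ p ι a b A₀ t + 1) * (M₀ ι A₀ t + 1)

lemma one_le_mrProd (t : ℝ) : 1 ≤ mrProd p ι a b A₀ t := by
  unfold mrProd
  calc (1 : ℝ≥0∞) = 1 * 1 := (mul_one 1).symm
    _ ≤ _ := mul_le_mul' le_add_self le_add_self

lemma one_le_toReal_mrProd {t : ℝ} (ht : mrProd p ι a b A₀ t ≠ ⊤) :
    1 ≤ (mrProd p ι a b A₀ t).toReal := by
  have := ENNReal.toReal_mono ht (one_le_mrProd t)
  simpa using this

lemma ε₀_eq (t : ℝ) : ε₀ p ι a b A₀ t = 1 / (2 * (mrProd p ι a b A₀ t).toReal) := by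
  unfold ε₀ mrProd
  rw [mul_assoc, ENNReal.toReal_div, ENNReal.toReal_mul (a := 2)]
  simp

lemma K₀_ne_top {t : ℝ} (ht : mrProd p ι a b A₀ t ≠ ⊤) : K₀ p ι a b A₀ t ≠ ⊤ := by
  intro h
  apply ht
  unfold mrProd
  rw [h, top_add, ENNReal.top_mul (by simp)]

lemma M₀_ne_top {t : ℝ} (ht : mrProd p ι a b A₀ t ≠ ⊤) : M₀ ι A₀ t ≠ ⊤ := by
  intro h
  apply ht
  unfold mrProd
  rw [h, top_add, ENNReal.mul_top (by simp)]

lemma exists_semigroup_and_bound {t : ℝ} (ht : mrProd p ι a b A₀ t ≠ ⊤) :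
    ∃ (S : ℝ → X →L[ℝ] X) (M : ℝ), IsSemigroupOf ι (A₀ t) S ∧ (∀ τ, 0 ≤ τ → ‖S τ‖ ≤ M) ∧
      M ≤ 2 * (mrProd p ι a b A₀ t).toReal ∧
      K₀ p ι a b A₀ t * (1 + ENNReal.ofReal M)
        ≤ ENNReal.ofReal (mrProd p ι a b A₀ t).toReal := by
  have hK := K₀_ne_top ht
  have hM := M₀_ne_top ht
  set k := (K₀ p ι a b A₀ t).toReal with hk
  set m := (M₀ ι A₀ t).toReal with hm
  have hk0 : 0 ≤ k := ENNReal.toReal_nonneg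
  have hm0 : 0 ≤ m := ENNReal.toReal_nonneg
  have hprod : (mrProd p ι a b A₀ t).toReal = (k + 1) * (m + 1) := by
    unfold mrProd
    rw [ENNReal.toReal_mul, ENNReal.toReal_add hK (by simp), ENNReal.toReal_add hM (by simp)]
    simp [hk, hm]
  -- M must exceed M₀ strictly. This slack is small enough that k(1+M) ≤ (k+1)(m+1), so no constant
  -- is lost against ε₀.
  set M := m + (m + 1) / (k + 1) with hMdef
  have hMm : m < M := by
    have : 0 < (m + 1) / (k + 1) := by positivity
    linarith
  obtain ⟨S, hS, hSM⟩ := exists_semigroup_of_semigroupBound_lt (ι := ι) (A₁ := A₀ t) (M := M) (by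
    change M₀ ι A₀ t < _
    rw [← ENNReal.ofReal_toReal hM]
    exact (ENNReal.ofReal_lt_ofReal_iff (by linarith)).2 hMm)
  refine ⟨S, M, hS, hSM, ?_, ?_⟩
  · rw [hprod]
    have h1 : (m + 1) / (k + 1) ≤ m + 1 := div_le_self (by linarith) (by linarith)
    nlinarith
  · rw [hprod, ← ENNReal.ofReal_toReal hK, ← ENNReal.ofReal_one,
      ← ENNReal.ofReal_add zero_le_one (by linarith), ← ENNReal.ofReal_mul hk0]
    refine ENNReal.ofReal_le_ofReal ?_
    rw [hMdef]
    have h1 : (k + 1) * ((m + 1) / (k + 1)) = m + 1 := by field_simp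
    have h2 : 0 ≤ (m + 1) / (k + 1) := by positivity
    nlinarith

/-- Walk from a in steps of length δ(1): each step raises the operator norm by at most 1 + η‖ι‖, and
finitely many steps reach b. -/
lemma RelCont.exists_norm_le (h : RelCont ι a b A) : ∃ L, ∀ t ∈ Icc a b, ‖A t‖ ≤ L := by
  obtain ⟨δ, η, hδ, hη, hest⟩ := h.est 1 one_pos
  have hstep : ∀ t ∈ Icc a b, ∀ s ∈ Icc a b, |t - s| ≤ δ → ‖A t‖ ≤ ‖A s‖ + (1 + η * ‖ι‖) := by
    intro t ht s hs hts
    have h1 : ‖A t - A s‖ ≤ 1 + η * ‖ι‖ := by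
      refine ContinuousLinearMap.opNorm_le_bound _ (by positivity) fun x => ?_
      refine (hest x t ht s hs hts).trans ?_
      rw [add_mul, mul_assoc]
      gcongr
      exact ι.le_opNorm x
    calc ‖A t‖ = ‖A s + (A t - A s)‖ := by congr 1; abel
      _ ≤ _ := (norm_add_le _ _).trans (add_le_add le_rfl h1)
  have key : ∀ n : ℕ, ∀ t ∈ Icc a b, t - a ≤ n * δ → ‖A t‖ ≤ ‖A a‖ + n * (1 + η * ‖ι‖) := by
    intro n
    induction n with
    | zero =>
      intro t ht hta
      have : t = a := by
        simp only [Nat.cast_zero, zero_mul] at hta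
        linarith [ht.1]
      rw [this]; simp
    | succ n ih =>
      intro t ht hta
      push_cast at hta ⊢
      have hab : a ≤ b := ht.1.trans ht.2
      have hs : max a (t - δ) ∈ Icc a b :=
        ⟨le_max_left _ _, max_le hab (by linarith [ht.2])⟩
      have h1 := ih _ hs (by
        rcases max_choice a (t - δ) with h | h <;> rw [h]
        · rw [sub_self]; positivity
        · linarith)
      have h2 := hstep t ht _ hs (by
        rcases max_choice a (t - δ) with h | h <;> rw [h]
        · rw [abs_of_nonneg (by linarith [ht.1])]
          have := le_max_right a (t - δ)
          rw [h] at this; linarith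
        · rw [sub_sub_cancel, abs_of_pos hδ])
      linarith
  obtain ⟨n, hn⟩ := exists_nat_ge ((b - a) / δ)
  rw [div_le_iff₀ hδ] at hn
  exact ⟨_, fun t ht => key n t ht (by linarith [ht.2])⟩

lemma RelCont.ae_norm_le_opNormInf (h : RelCont ι a b A) :
    ∀ᵐ t ∂(volume.restrict (Ioo a b)), ‖A t‖ ≤ opNormInf (Ioo a b) A := by
  obtain ⟨L, hL⟩ := h.exists_norm_le
  have hfin : essSup (fun t => ‖A t‖ₑ) (volume.restrict (Ioo a b)) ≠ ⊤ := by
    refine ne_top_of_le_ne_top (ENNReal.ofReal_ne_top (r := L)) (essSup_le_of_ae_le _ ?_)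
    filter_upwards [ae_restrict_mem measurableSet_Ioo] with t ht
    rw [← ofReal_norm]
    exact ENNReal.ofReal_le_ofReal (hL t (Ioo_subset_Icc_self ht))
  filter_upwards [ENNReal.ae_le_essSup (μ := volume.restrict (Ioo a b)) fun t => ‖A t‖ₑ] with t ht
  have := ENNReal.toReal_mono hfin ht
  rwa [toReal_enorm] at this

/-! ### Freezing points and the estimate on one cell. -/

lemma exists_mem_Ioo_lt_of_lintegral_lt {F : ℝ → ℝ≥0∞} {θ : ℝ≥0∞} (hcd : Ioo c d ⊆ Ioo a b)
    (h : ∫⁻ t in Ioo a b, F t < θ * ENNReal.ofReal (d - c)) : ∃ t ∈ Ioo c d, F t < θ := by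
  by_contra! hcon
  refine absurd h (not_lt.2 ?_)
  calc θ * ENNReal.ofReal (d - c) = ∫⁻ _ in Ioo c d, θ := by
        rw [setLIntegral_const, Real.volume_Ioo]
    _ ≤ ∫⁻ t in Ioo c d, F t := setLIntegral_mono' measurableSet_Ioo hcon
    _ ≤ ∫⁻ t in Ioo a b, F t := lintegral_mono_set hcd

/-- Chebyshev's inequality for h^{αr}, whose integral is Γ^r, with threshold τ^r and τ =
m_δ/(2^α(d-c)). The conclusion says that d - c < δ_A(ε₀(t)), so the whole cell lies within the range
in which the perturbation from A₀(t) is controlled. -/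
lemma exists_good_point {r α mδ : ℝ} (hr : 1 < r) (hα : 1 ≤ α) (hmδ : 0 < mδ)
    (hΓ : Γ p r α ι a b A₀ < ⊤) (hcd : c < d) (hsub : Ioo c d ⊆ Ioo a b)
    (h : (2 ^ α * ((Γ p r α ι a b A₀).toReal / mδ)) ^ rStar r < (d - c)⁻¹) :
    ∃ t ∈ Ioo c d, mrProd p ι a b A₀ t ≠ ⊤ ∧
      (2 * (mrProd p ι a b A₀ t).toReal) ^ α < mδ / (d - c) := by
  have hℓ : 0 < d - c := sub_pos.2 hcd
  have hr0 : 0 < r := by linarith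
  have hα0 : 0 < α := by linarith
  set τ := mδ / (2 ^ α * (d - c)) with hτ
  have hτ0 : 0 < τ := by positivity
  have h1 := rpow_lt_of_lt_inv hr ENNReal.toReal_nonneg hmδ hℓ h
  have h2 : ∫⁻ t in Ioo a b, mrProd p ι a b A₀ t ^ (α * r)
      < ENNReal.ofReal (τ ^ r) * ENNReal.ofReal (d - c) := by
    have e : ∫⁻ t in Ioo a b, mrProd p ι a b A₀ t ^ (α * r) = Γ p r α ι a b A₀ ^ r := by
      unfold Γ mrProd
      rw [one_div, ENNReal.rpow_inv_rpow hr0.ne']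
      refine lintegral_congr fun t => ?_
      rw [ENNReal.mul_rpow_of_nonneg _ _ (by positivity)]
    rw [e, ← ENNReal.ofReal_toReal hΓ.ne, ENNReal.ofReal_rpow_of_nonneg ENNReal.toReal_nonneg hr0.le,
      ← ENNReal.ofReal_mul (by positivity)]
    exact (ENNReal.ofReal_lt_ofReal_iff (by positivity)).2 h1
  obtain ⟨t, ht, hlt⟩ := exists_mem_Ioo_lt_of_lintegral_lt hsub h2
  have hfin : mrProd p ι a b A₀ t ≠ ⊤ := by
    intro htop
    rw [htop, ENNReal.top_rpow_of_pos (by positivity)] at hlt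
    exact not_top_lt hlt
  refine ⟨t, ht, hfin, ?_⟩
  have hh := one_le_toReal_mrProd hfin
  rw [← ENNReal.ofReal_toReal hfin, ENNReal.ofReal_rpow_of_nonneg ENNReal.toReal_nonneg
    (by positivity), ENNReal.ofReal_lt_ofReal_iff (by positivity),
    Real.rpow_mul ENNReal.toReal_nonneg, Real.rpow_lt_rpow_iff (by positivity) hτ0.le hr0, hτ,
    lt_div_iff₀ (by positivity)] at hlt
  rw [lt_div_iff₀ hℓ, Real.mul_rpow zero_le_two (by positivity)]
  linarith

lemma Γ_pos {r α : ℝ} (hr : 0 < r) (hα : 0 < α) (hab : a < b) : 0 < Γ p r α ι a b A₀ := by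
  unfold Γ
  refine ENNReal.rpow_pos_of_nonneg ?_ (by positivity)
  refine lt_of_lt_of_le (b := ∫⁻ _ in Ioo a b, (1 : ℝ≥0∞)) ?_ (lintegral_mono fun t => ?_)
  · rw [setLIntegral_one, Real.volume_Ioo]
    exact ENNReal.ofReal_pos.2 (sub_pos.2 hab)
  · have h : 0 < α * r := by positivity
    calc (1 : ℝ≥0∞) = 1 * 1 := (mul_one 1).symm
      _ ≤ _ := mul_le_mul' (ENNReal.one_le_rpow le_add_self h) (ENNReal.one_le_rpow le_add_self h)

/-- The perturbation result with κ = h, for which κε₀ = 1/2. Since ε₀^{-β} = (2h)^β and M ≤ 2h, the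
product ηM is at most m_η z^{β+1}, a bound common to all cells. -/
lemma AssumptionA1.wellPosed_cell [CompleteSpace X] {α β r mδ mη t z L : ℝ} (hp : 1 < p)
    (hι : Function.Injective ι) (hβ : 0 ≤ β)
    (h1 : AssumptionA1 p ι a b A A₀ B δ η)
    (h2 : AssumptionA2 p r α β mδ mη ι a b A₀ δ η)
    (hL : ∀ᵐ t ∂(volume.restrict (Ioo a b)), ‖A t‖ ≤ L) (hsub : Ioo c d ⊆ Ioo a b)
    (hab : d - c ≤ b - a) (ht : t ∈ Ioo c d) (hfin : mrProd p ι a b A₀ t ≠ ⊤)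
    (hlt : (2 * (mrProd p ι a b A₀ t).toReal) ^ α < mδ / (d - c))
    (hz : 2 * (mrProd p ι a b A₀ t).toReal ≤ z) :
    WellPosed p ι A c d
      (ENNReal.ofReal (2 * z * Real.exp ((4 * mη * z ^ (β + 1) + 1) * (d - c)))) := by
  have hcd : c < d := ht.1.trans ht.2
  have hℓ : 0 < d - c := sub_pos.2 hcd
  have hh := one_le_toReal_mrProd hfin
  obtain ⟨S, M, hS, hSM, hM2, hKM⟩ := exists_semigroup_and_bound hfin
  have hM0 : 0 ≤ M := (norm_nonneg _).trans (hSM 0 le_rfl)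
  have hε := ε₀_eq (p := p) (ι := ι) (a := a) (b := b) (A₀ := A₀) t
  set h := (mrProd p ι a b A₀ t).toReal with hdef
  have hε0 : 0 < ε₀ p ι a b A₀ t := by rw [hε]; positivity
  have hη0 := h1.range.nonneg _ hε0
  have hηle := h2.η_le _ hε0
  have hδ : d - c ≤ δ (ε₀ p ι a b A₀ t) := by
    rw [h2.δ_eq _ hε0, hε, Real.div_rpow zero_le_one (by positivity), Real.one_rpow, mul_one_div,
      le_div_iff₀ (by positivity)]
    rw [lt_div_iff₀ hℓ] at hlt
    linarith
  have hm : volume.restrict (Ioo c d) ≤ volume.restrict (Ioo a b) :=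
    Measure.restrict_mono hsub le_rfl
  have hwp := wellPosed_of_perturbation (A := A) (L := L) (κ := h) hp hι hcd hab
    (h1.pointwiseMR t (hsub ht)) hS hSM
    (isMRBound_mrConst (A := fun _ => A₀ t) (K₀_ne_top hfin)) hKM (by linarith) hε0.le hη0
    (le_of_eq (by rw [hε]; field_simp))
    (fun x => (h1.relCont.stronglyMeasurable x).mono_measure hm) (ae_mono hm hL) (by
      intro s hs x
      have e : A s x - A₀ t x = B t s x := by
        rw [h1.decomp t (hsub ht) s (hsub hs), add_apply, add_sub_cancel_left]
      rw [e]
      refine h1.perturbation x t (hsub ht) s (hsub hs) (le_trans ?_ hδ)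
      rw [abs_le]
      constructor <;> linarith [ht.1, ht.2, hs.1, hs.2])
  refine hwp.mono (ENNReal.ofReal_le_ofReal ?_)
  have hz0 : 0 < z := by linarith
  have hηM : η (ε₀ p ι a b A₀ t) * M ≤ mη * z ^ (β + 1) := by
    have h3 : (ε₀ p ι a b A₀ t) ^ (-β) = (2 * h) ^ β := by
      rw [hε, one_div, Real.inv_rpow (by positivity), Real.rpow_neg (by positivity), inv_inv]
    rw [h3] at hηle
    have h4 : (2 * h) ^ β ≤ z ^ β := Real.rpow_le_rpow (by positivity) hz hβ
    have hmη := h2.mη_nonneg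
    calc η (ε₀ p ι a b A₀ t) * M ≤ (mη * z ^ β) * z := by
          refine mul_le_mul (hηle.trans ?_) (hM2.trans hz) hM0 (by positivity)
          gcongr
      _ = mη * z ^ (β + 1) := by rw [Real.rpow_add_one hz0.ne']; ring
  have h5 : 4 * h ≤ 2 * z := by linarith
  refine mul_le_mul h5 (Real.exp_le_exp.2 ?_) (Real.exp_pos _).le (by positivity)
  refine mul_le_mul_of_nonneg_right ?_ hℓ.le
  linarith

end Assumptions

/-! ### Maximal regularity of the nonautonomous operator -/

section Main

variable {p : ℝ} {ι : D →L[ℝ] X} {a b c d : ℝ} {A A₀ : ℝ → D →L[ℝ] X} {B : ℝ → ℝ → D →L[ℝ] X}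
  {δ η : ℝ → ℝ} {f : ℝ → X} {u : ℝ → D} {w : ℝ → X}

lemma eLpNorm_smul_const {E : Type*} [NormedAddCommGroup E] [NormedSpace ℝ E] {q : ℝ≥0∞}
    {μ : Measure ℝ} (φ : ℝ → ℝ) (x : E) :
    eLpNorm (fun t => φ t • x) q μ = ‖x‖ₑ * eLpNorm φ q μ := by
  have h1 : eLpNorm (fun t => φ t • x) q μ = eLpNorm (fun t => ‖x‖ • φ t) q μ :=
    eLpNorm_congr_norm_ae (Eventually.of_forall fun t => by
      rw [norm_smul, norm_smul, norm_norm, mul_comm])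
  have h2 := eLpNorm_const_smul ‖x‖ φ q μ
  rw [enorm_norm] at h2
  exact h1.trans h2

/-- Test the maximal regularity inequality on u(t) = (t-a)x, whose data are ιx + (t-a)A₁x. The
coefficient of ‖A₁x‖ comes out as K itself, which is what a perturbation with Kε ≤ 1/2 requires. -/
lemma exists_norm_le_of_isMRBound [CompleteSpace X] {A₁ : D →L[ℝ] X} {K : ℝ≥0∞} (hp : 1 < p)
    (hab : a < b)
    (hK : IsMRBound p ι (Ioo a b) (fun _ => A₁) K) (hKt : K ≠ ⊤) :
    ∃ C : ℝ, 0 ≤ C ∧ ∀ x, ‖x‖ ≤ K.toReal * ‖A₁ x‖ + C * ‖ι x‖ := by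
  have hp1 : 1 ≤ ENNReal.ofReal p := ENNReal.one_le_ofReal.2 hp.le
  set μ := volume.restrict (Ioo a b) with hμ
  have hφc : Continuous fun t : ℝ => t - a := by fun_prop
  have hφD : ∀ x : D, MemLp (fun t : ℝ => (t - a) • x) (ENNReal.ofReal p) μ := fun x =>
    memLp_continuous_smul hφc (memLp_const x)
  have hφX : ∀ x : X, MemLp (fun t : ℝ => (t - a) • x) (ENNReal.ofReal p) μ := fun x =>
    memLp_continuous_smul hφc (memLp_const x)
  have h1m : MemLp (fun _ : ℝ => (1 : ℝ)) (ENNReal.ofReal p) μ := memLp_const 1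
  have hφm' : MemLp (fun t : ℝ => t - a) (ENNReal.ofReal p) μ := by
    simpa using memLp_continuous_smul hφc h1m
  set θ := eLpNorm (fun t : ℝ => t - a) (ENNReal.ofReal p) μ with hθ
  set σ := eLpNorm (fun _ : ℝ => (1 : ℝ)) (ENNReal.ofReal p) μ with hσ
  have hθt : θ ≠ ⊤ := hφm'.2.ne
  have hσt : σ ≠ ⊤ := h1m.2.ne
  have hθ0 : θ ≠ 0 := by
    rw [hθ, Ne, eLpNorm_eq_zero_iff hφm'.1 (by positivity)]
    intro h
    have h2 : ∀ᵐ t ∂μ, False := by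
      filter_upwards [h, ae_restrict_mem measurableSet_Ioo] with t ht htI
      have : t - a = 0 := ht
      linarith [htI.1]
    rw [ae_iff] at h2
    simp only [not_false_eq_true, ofPred_true, hμ, Measure.restrict_apply_univ, Real.volume_Ioo,
      ENNReal.ofReal_eq_zero] at h2
    linarith
  refine ⟨K.toReal * σ.toReal / θ.toReal, by positivity, fun x => ?_⟩
  have hcs : MemLp (fun _ : ℝ => ι x) (ENNReal.ofReal p) μ := memLp_const _
  have hsol : IsMildSol p ι a b (fun _ => A₁) (fun t => ι x + (t - a) • A₁ x)
      (fun t => (t - a) • x) (fun _ => ι x) := by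
    refine ⟨hφD x, hcs, ?_, ?_⟩
    · filter_upwards with t
      rw [map_smul]
    · filter_upwards with t
      rw [map_smul, intervalIntegral.integral_const]
  have h1 := (eLpNorm_le_mrNorm (by linarith) _ _ _).trans
    (hK _ _ _ (hcs.add (hφX (A₁ x))) (hsol.isSolution hp.le hab))
  have h2 : eLpNorm ((fun _ : ℝ => ι x) + fun t : ℝ => (t - a) • A₁ x) (ENNReal.ofReal p) μ
      ≤ ‖ι x‖ₑ * σ + ‖A₁ x‖ₑ * θ := by
    refine (eLpNorm_add_le hcs.1 (hφX (A₁ x)).1 hp1).trans (add_le_add (le_of_eq ?_) (le_of_eq ?_))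
    · have := eLpNorm_smul_const (q := ENNReal.ofReal p) (μ := μ) (fun _ => (1 : ℝ)) (ι x)
      simpa only [one_smul] using this
    · exact eLpNorm_smul_const _ _
  have h3 : ‖x‖ₑ * θ ≤ K * (‖ι x‖ₑ * σ + ‖A₁ x‖ₑ * θ) := by
    rw [← eLpNorm_smul_const (fun t : ℝ => t - a) x]
    exact h1.trans (mul_le_mul_right h2 _)
  have hA : ‖ι x‖ₑ * σ ≠ ⊤ := ENNReal.mul_ne_top enorm_ne_top hσt
  have hB : ‖A₁ x‖ₑ * θ ≠ ⊤ := ENNReal.mul_ne_top enorm_ne_top hθt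
  have h4 := ENNReal.toReal_mono (ENNReal.mul_ne_top hKt (ENNReal.add_ne_top.2 ⟨hA, hB⟩)) h3
  rw [ENNReal.toReal_mul, ENNReal.toReal_mul, ENNReal.toReal_add hA hB, ENNReal.toReal_mul,
    ENNReal.toReal_mul, toReal_enorm, toReal_enorm, toReal_enorm] at h4
  have hθpos : 0 < θ.toReal := ENNReal.toReal_pos hθ0 hθt
  have h5 : ‖x‖ ≤ K.toReal * (‖ι x‖ * σ.toReal + ‖A₁ x‖ * θ.toReal) / θ.toReal :=
    (le_div_iff₀ hθpos).2 h4
  refine h5.trans (le_of_eq ?_)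
  field_simp
  ring

/-- Insert A₀(t)x = A(s)x - B(t,s)x into the lower estimate for A₀(t) and absorb the D norm of x
using K₀ε₀ ≤ 1/2. It holds at every s near t, not just almost every s. -/
lemma AssumptionA1.graphNormEquiv [CompleteSpace X] {s t : ℝ} (hp : 1 < p) (hab : a < b)
    (h : AssumptionA1 p ι a b A A₀ B δ η) (hs : s ∈ Ioo a b) (ht : t ∈ Ioo a b)
    (hfin : mrProd p ι a b A₀ t ≠ ⊤) (hts : |t - s| ≤ δ (ε₀ p ι a b A₀ t)) :
    GraphNormEquiv ι (A s) := by
  obtain ⟨C, hC, hle⟩ := exists_norm_le_of_isMRBound hp hab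
    (isMRBound_mrConst (p := p) (ι := ι) (A := fun _ => A₀ t) (K₀_ne_top hfin)) (K₀_ne_top hfin)
  have hle' : ∀ x, ‖x‖ ≤ (K₀ p ι a b A₀ t).toReal * ‖A₀ t x‖ + C * ‖ι x‖ := hle
  have hh := one_le_toReal_mrProd hfin
  have hε := ε₀_eq (p := p) (ι := ι) (a := a) (b := b) (A₀ := A₀) t
  have hKh : (K₀ p ι a b A₀ t).toReal ≤ (mrProd p ι a b A₀ t).toReal := by
    refine ENNReal.toReal_mono hfin ?_
    unfold mrProd
    calc K₀ p ι a b A₀ t = K₀ p ι a b A₀ t * 1 := (mul_one _).symm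
      _ ≤ _ := mul_le_mul' le_self_add le_add_self
  have hε0 : 0 < ε₀ p ι a b A₀ t := by rw [hε]; positivity
  have hη0 := h.range.nonneg _ hε0
  have hKε : (K₀ p ι a b A₀ t).toReal * ε₀ p ι a b A₀ t ≤ 1 / 2 := by
    calc _ ≤ (mrProd p ι a b A₀ t).toReal * ε₀ p ι a b A₀ t := by gcongr
      _ = 1 / 2 := by rw [hε]; field_simp
  set k := (K₀ p ι a b A₀ t).toReal
  have hk : 0 ≤ k := ENNReal.toReal_nonneg
  set e := η (ε₀ p ι a b A₀ t)
  set m := 2 * (k + k * e + C + 1) with hm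
  have hm0 : 0 < m := by positivity
  refine ⟨m⁻¹, ‖ι‖ + ‖A s‖ + 1, by positivity, by positivity, fun x => ⟨?_, ?_⟩⟩
  · rw [inv_mul_le_iff₀ hm0]
    have h1 : ‖A₀ t x‖ ≤ ‖A s x‖ + (ε₀ p ι a b A₀ t * ‖x‖ + e * ‖ι x‖) := by
      have e1 : A₀ t x = A s x - B t s x := by
        rw [h.decomp t ht s hs, add_apply, add_sub_cancel_right]
      rw [e1]
      exact (norm_sub_le _ _).trans (add_le_add le_rfl (h.perturbation x t ht s hs hts))
    have h2 := hle' x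
    have h3 := mul_le_mul_of_nonneg_left h1 hk
    have h4 := mul_le_mul_of_nonneg_right hKε (norm_nonneg x)
    have n1 := norm_nonneg (A s x)
    have n2 := norm_nonneg (ι x)
    have g1 := mul_nonneg hk n2
    have g2 := mul_nonneg (mul_nonneg hk hη0) n1
    have g3 := mul_nonneg hC n1
    rw [hm]
    linarith
  · have h1 := ι.le_opNorm x
    have h2 := (A s).le_opNorm x
    have h3 := norm_nonneg x
    linarith

/-- Since ιu is a primitive, Hölder's inequality gives ‖ιu‖_p ≤ |I|‖w‖_p. The factor 2 counts this
term and the weighted derivative. -/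
lemma IsMildSol.mrNorm_le (hp : 1 ≤ p) (hcd : c < d) (h : IsMildSol p ι c d A f u w) :
    mrNorm p ι (Ioo c d) u w ≤ eLpNorm u (ENNReal.ofReal p) (volume.restrict (Ioo c d))
      + 2 * ENNReal.ofReal (d - c) *
        eLpNorm w (ENNReal.ofReal p) (volume.restrict (Ioo c d)) := by
  have hp0 : 0 < p := by linarith
  have hp1 : 1 ≤ ENNReal.ofReal p := ENNReal.one_le_ofReal.2 hp
  have hq : (ENNReal.ofReal p).toReal = p := ENNReal.toReal_ofReal hp0.le
  set T := ENNReal.ofReal (d - c) with hT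
  have hT0 : T ≠ 0 := (ENNReal.ofReal_pos.2 (sub_pos.2 hcd)).ne'
  have hTt : T ≠ ⊤ := ENNReal.ofReal_ne_top
  have hvol : volume.restrict (Ioo c d) univ = T := by
    rw [Measure.restrict_apply_univ, Real.volume_Ioo]
  have hw1 := integrableOn_of_memLp hp h.memLp_deriv
  have hweight : weight (Ioo c d) = T := by
    unfold weight
    rw [Real.volume_Ioo, if_neg hTt]
  set W := eLpNorm w (ENNReal.ofReal p) (volume.restrict (Ioo c d)) with hW
  have h1 : eLpNorm w 1 (volume.restrict (Ioo c d)) ≤ W * T ^ (1 - 1 / p) := by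
    have := eLpNorm_le_eLpNorm_mul_rpow_measure_univ hp1 h.memLp_deriv.1
    rwa [hvol, hq, ENNReal.toReal_one, div_one] at this
  have h2 : eLpNorm (fun t => ι (u t)) (ENNReal.ofReal p) (volume.restrict (Ioo c d))
      ≤ T ^ p⁻¹ * eLpNorm w 1 (volume.restrict (Ioo c d)) := by
    have hfin : eLpNorm w 1 (volume.restrict (Ioo c d)) ≠ ⊤ :=
      (memLp_one_iff_integrable.2 hw1).2.ne
    have := eLpNorm_le_of_ae_bound (p := ENNReal.ofReal p) (μ := volume.restrict (Ioo c d))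
      (f := fun t => ι (u t)) (C := (eLpNorm w 1 (volume.restrict (Ioo c d))).toReal) (by
        filter_upwards [h.integral, ae_restrict_mem measurableSet_Ioo] with t ht htI
        rw [ht, intervalIntegral.integral_of_le htI.1.le, eLpNorm_one_eq_lintegral_enorm,
          ← integral_norm_eq_lintegral_enorm h.memLp_deriv.1]
        have hsub : Ioc c t ⊆ Ioo c d := fun s hs => ⟨hs.1, hs.2.trans_lt htI.2⟩
        exact (norm_integral_le_integral_norm _).trans
          (setIntegral_mono_set hw1.norm (Eventually.of_forall fun _ => norm_nonneg _)
            hsub.eventuallyLE))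
    rwa [hvol, hq, ENNReal.ofReal_toReal hfin] at this
  have h3 : eLpNorm (fun t => ι (u t)) (ENNReal.ofReal p) (volume.restrict (Ioo c d)) ≤ T * W := by
    calc _ ≤ T ^ p⁻¹ * (W * T ^ (1 - 1 / p)) := h2.trans (mul_le_mul_right h1 _)
      _ = T ^ p⁻¹ * T ^ (1 - 1 / p) * W := by ring
      _ = T * W := by
        rw [← ENNReal.rpow_add _ _ hT0 hTt, one_div, add_sub_cancel, ENNReal.rpow_one]
  unfold mrNorm
  rw [hweight]
  set U := eLpNorm u (ENNReal.ofReal p) (volume.restrict (Ioo c d))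
  set V := eLpNorm (fun t => ι (u t)) (ENNReal.ofReal p) (volume.restrict (Ioo c d))
  rw [← ENNReal.mul_rpow_of_nonneg _ _ hp0.le]
  calc (V ^ p + U ^ p + (T * W) ^ p) ^ (1 / p)
      ≤ ((V + U) ^ p + (T * W) ^ p) ^ (1 / p) :=
        ENNReal.rpow_le_rpow (add_le_add (ENNReal.add_rpow_le_rpow_add _ _ hp) le_rfl)
          (by positivity)
    _ ≤ V + U + T * W := ENNReal.rpow_add_rpow_le_add _ _ hp
    _ ≤ T * W + U + T * W := by gcongr
    _ = U + 2 * T * W := by ring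

lemma WellPosed.isMRBound [CompleteSpace X] {κ : ℝ≥0∞} {L : ℝ} (hp : 1 ≤ p) (hab : a < b)
    (hAm : ∀ x : D, AEStronglyMeasurable (fun t => A t x) (volume.restrict (Ioo a b)))
    (hAL : ∀ᵐ t ∂(volume.restrict (Ioo a b)), ‖A t‖ ≤ L) (h : WellPosed p ι A a b κ) :
    IsMRBound p ι (Ioo a b) A
      (κ + 2 * ENNReal.ofReal (b - a) * (1 + ENNReal.ofReal L * κ)) := by
  intro f u w hf hu
  have hm := hu.isMildSol hp hab
  have h1 := (h f hf).2 u w hm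
  have h2 := hm.eLpNorm_deriv_le hp hAm hAL hf
  refine (hm.mrNorm_le hp hab).trans ?_
  set F := eLpNorm f (ENNReal.ofReal p) (volume.restrict (Ioo a b))
  calc _ ≤ κ * F + 2 * ENNReal.ofReal (b - a) * (F + ENNReal.ofReal L * (κ * F)) := by
        refine add_le_add h1 (mul_le_mul_right (h2.trans ?_) _)
        gcongr
    _ = _ := by ring

lemma WellPosed.hasMR [CompleteSpace X] {κ : ℝ≥0∞} {L : ℝ} (hp : 1 ≤ p) (hab : a < b)
    (hAm : ∀ x : D, AEStronglyMeasurable (fun t => A t x) (volume.restrict (Ioo a b)))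
    (hAL : ∀ᵐ t ∂(volume.restrict (Ioo a b)), ‖A t‖ ≤ L) (hκ : κ ≠ ⊤)
    (hG : ∀ t ∈ Ioo a b, GraphNormEquiv ι (A t)) (h : WellPosed p ι A a b κ) :
    HasMR p ι (Ioo a b) A where
  memLinf x := memLp_top_of_bound (hAm x) (L * ‖x‖) (by
    filter_upwards [hAL] with t ht using (A t).le_of_opNorm_le ht x)
  graphNorm := hG
  exists_solution f hf := by
    obtain ⟨u, w, huw⟩ := (h f hf).1
    exact ⟨u, w, huw.isSolution hp hab⟩
  unique_solution f hf u₁ u₂ w₁ w₂ h₁ h₂ := by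
    have hs := (h₁.isMildSol hp hab).sub hp (h₂.isMildSol hp hab)
    have h0 := (h _ (hf.sub hf)).2 _ _ hs
    have hz : eLpNorm (f - f) (ENNReal.ofReal p) (volume.restrict (Ioo a b)) = 0 := by simp
    rw [hz, mul_zero, nonpos_iff_eq_zero,
      eLpNorm_eq_zero_iff hs.memLp.1 (ENNReal.ofReal_pos.2 (by linarith)).ne'] at h0
    filter_upwards [h0] with t ht
    exact sub_eq_zero.1 ht
  exists_bound := ⟨_, ENNReal.add_ne_top.2 ⟨hκ, ENNReal.mul_ne_top
    (ENNReal.mul_ne_top (by simp) ENNReal.ofReal_ne_top) (ENNReal.add_ne_top.2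
      ⟨by simp, ENNReal.mul_ne_top ENNReal.ofReal_ne_top hκ⟩)⟩, h.isMRBound hp hab hAm hAL⟩

lemma log_mrConst_le [CompleteSpace X] {z E L ℓ : ℝ} {N : ℕ} (hp : 1 ≤ p) (hab : a < b)
    (hAm : ∀ x : D, AEStronglyMeasurable (fun t => A t x) (volume.restrict (Ioo a b)))
    (hAL : ∀ᵐ t ∂(volume.restrict (Ioo a b)), ‖A t‖ ≤ L) (hL : 0 ≤ L) (hz : 1 ≤ z)
    (hE : 0 ≤ E * ℓ)
    (h : WellPosed p ι A a b ((2 + ENNReal.ofReal (2 * z * Real.exp (E * ℓ)) *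
      (2 + 2 * ENNReal.ofReal L)) ^ N)) :
    ENNReal.log (mrConst p ι (Ioo a b) A) ≤
      ((Real.log (1 + 2 * (b - a) * (1 + L)) + N * (Real.log z + Real.log (2 * (3 + 2 * L)))
        + N * ℓ * E : ℝ) : EReal) := by
  have hT : 0 < b - a := sub_pos.2 hab
  -- One cell contributes at most q, because 2 ≤ 2z e^{Eℓ}.
  set q := z * (2 * (3 + 2 * L)) * Real.exp (E * ℓ) with hq
  have hexp : 1 ≤ Real.exp (E * ℓ) := Real.one_le_exp hE
  have hzexp : 1 ≤ z * Real.exp (E * ℓ) := one_le_mul_of_one_le_of_one_le hz hexp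
  have hq1 : 1 ≤ q := by
    have : q = z * Real.exp (E * ℓ) * (2 * (3 + 2 * L)) := by rw [hq]; ring
    rw [this]
    exact one_le_mul_of_one_le_of_one_le hzexp (by linarith)
  have h1 : 2 + ENNReal.ofReal (2 * z * Real.exp (E * ℓ)) * (2 + 2 * ENNReal.ofReal L)
      ≤ ENNReal.ofReal q := by
    have e2 : (2 : ℝ≥0∞) = ENNReal.ofReal 2 := by simp
    rw [e2, ← ENNReal.ofReal_mul zero_le_two, ← ENNReal.ofReal_add zero_le_two (by positivity),
      ← ENNReal.ofReal_mul (by positivity), ← ENNReal.ofReal_add zero_le_two (by positivity)]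
    refine ENNReal.ofReal_le_ofReal ?_
    rw [hq]
    linarith
  have h2 := h.mono (pow_le_pow_left₀ zero_le h1 N)
  rw [← ENNReal.ofReal_pow (by linarith)] at h2
  have hQ1 : 1 ≤ q ^ N := one_le_pow₀ hq1
  have h3 : mrConst p ι (Ioo a b) A ≤ ENNReal.ofReal (q ^ N * (1 + 2 * (b - a) * (1 + L))) := by
    refine (sInf_le (h2.isMRBound hp hab hAm hAL)).trans ?_
    have e2 : (2 : ℝ≥0∞) = ENNReal.ofReal 2 := by simp
    rw [e2, ← ENNReal.ofReal_one, ← ENNReal.ofReal_mul hL, ← ENNReal.ofReal_mul zero_le_two,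
      ← ENNReal.ofReal_add zero_le_one (by positivity), ← ENNReal.ofReal_mul (by positivity),
      ← ENNReal.ofReal_add (by positivity) (by positivity)]
    refine ENNReal.ofReal_le_ofReal ?_
    have := mul_le_mul_of_nonneg_left hQ1 (by positivity : 0 ≤ 2 * (b - a))
    linarith
  refine (ENNReal.log_monotone h3).trans ?_
  have hpos : 0 < 1 + 2 * (b - a) * (1 + L) := by positivity
  rw [ENNReal.log_ofReal_of_pos (by positivity), EReal.coe_le_coe_iff,
    Real.log_mul (by positivity) hpos.ne', Real.log_pow, hq,
    Real.log_mul (by positivity) (Real.exp_pos _).ne', Real.log_mul (by positivity) (by positivity),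
    Real.log_exp]
  linarith

end Main

/-! ### Assembly over the partition. -/

theorem main_estimate [CompleteSpace X] {ι : D →L[ℝ] X} (hι : Function.Injective ι)
    {p r α β a b mδ mη C : ℝ} (hp : 1 < p) (hr : 1 < r) (hα : 1 ≤ α) (hβ : 0 ≤ β) (hab : a < b)
    {A A₀ : ℝ → D →L[ℝ] X} {B : ℝ → ℝ → D →L[ℝ] X} {δ η : ℝ → ℝ}
    (h1 : AssumptionA1 p ι a b A A₀ B δ η) (h2 : AssumptionA2 p r α β mδ mη ι a b A₀ δ η)
    (hC : ∀ (mδ mη G z : ℝ) (N : ℕ), 0 < mδ → mδ ≤ 1 → 0 ≤ mη → 0 < G →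
      (N : ℝ) ≤ (b - a) * (2 ^ α * (G / mδ)) ^ rStar r + 1 → 1 ≤ z →
      z ^ α = mδ * N / (b - a) →
      Real.log (1 + 2 * (b - a) * (1 + opNormInf (Ioo a b) A))
          + N * (Real.log z + Real.log (2 * (3 + 2 * opNormInf (Ioo a b) A)))
          + (b - a) * (4 * mη * z ^ (β + 1) + 1)
        ≤ C * ((G / mδ) ^ rStar r *
            (1 + mη * mδ ^ s₂ α β r * G ^ s₁ α β r + Real.log (G / mδ)) + mη + 1)) :
    HasMR p ι (Ioo a b) A ∧
      ENNReal.log (mrConst p ι (Ioo a b) A) ≤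
        ((C * (((Γ p r α ι a b A₀).toReal / mδ) ^ rStar r *
            (1 + mη * mδ ^ s₂ α β r * (Γ p r α ι a b A₀).toReal ^ s₁ α β r
              + Real.log ((Γ p r α ι a b A₀).toReal / mδ)) + mη + 1) : ℝ) : EReal) := by
  have hT : 0 < b - a := sub_pos.2 hab
  have hα0 : 0 < α := by linarith
  have hmδ := h2.mδ_pos
  have hmη := h2.mη_nonneg
  set L := opNormInf (Ioo a b) A
  have hL0 : 0 ≤ L := ENNReal.toReal_nonneg
  have hAL : ∀ᵐ t ∂(volume.restrict (Ioo a b)), ‖A t‖ ≤ L := h1.relCont.ae_norm_le_opNormInf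
  have hAm := h1.relCont.stronglyMeasurable
  have hG0 : 0 < (Γ p r α ι a b A₀).toReal :=
    ENNReal.toReal_pos (Γ_pos (by linarith) hα0 hab).ne' h2.integrable.ne
  set G := (Γ p r α ι a b A₀).toReal with hG
  set Y := (b - a) * (2 ^ α * (G / mδ)) ^ rStar r with hY
  have hY0 : 0 ≤ Y := by positivity
  -- The integer ⌊Y⌋ + 1 exceeds Y strictly, as Chebyshev's inequality requires, and is at most Y +
  -- 1, as the final count requires.
  obtain ⟨N, hN0, hNle, hltN⟩ : ∃ N : ℕ, 0 < N ∧ (N : ℝ) ≤ Y + 1 ∧ Y < N :=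
    ⟨⌊Y⌋₊ + 1, Nat.succ_pos _, by push_cast; linarith [Nat.floor_le hY0],
      by push_cast; exact Nat.lt_floor_add_one Y⟩
  have hNr : (0 : ℝ) < N := Nat.cast_pos.2 hN0
  set ℓ := (b - a) / N with hℓ
  have hℓ0 : 0 < ℓ := by positivity
  have hNℓ : N * ℓ = b - a := by rw [hℓ]; field_simp
  have hsmall : (2 ^ α * (G / mδ)) ^ rStar r < ℓ⁻¹ := by
    rw [hℓ, inv_div, lt_div_iff₀ hT, mul_comm]
    exact hltN
  -- The common upper bound for 2h at the good points of all cells.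
  set z := (mδ / ℓ) ^ α⁻¹ with hz
  have hzα : z ^ α = mδ / ℓ := Real.rpow_inv_rpow (by positivity) hα0.ne'
  have hcell : ∀ k : ℕ, k < N → Ioo (a + k * ℓ) (a + (k + 1) * ℓ) ⊆ Ioo a b := by
    intro k hk
    have h3 : ((k + 1 : ℕ) : ℝ) ≤ N := by exact_mod_cast hk
    push_cast at h3
    have h4 : ((k : ℝ) + 1) * ℓ ≤ N * ℓ := mul_le_mul_of_nonneg_right h3 hℓ0.le
    refine Ioo_subset_Ioo (le_add_of_nonneg_right (by positivity)) ?_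
    linarith
  have hlen : ∀ k : ℕ, a + ((k : ℝ) + 1) * ℓ - (a + k * ℓ) = ℓ := fun k => by ring
  have hgood : ∀ k : ℕ, k < N → ∃ t ∈ Ioo (a + k * ℓ) (a + (k + 1) * ℓ),
      mrProd p ι a b A₀ t ≠ ⊤ ∧ (2 * (mrProd p ι a b A₀ t).toReal) ^ α < mδ / ℓ := by
    intro k hk
    have := exists_good_point hr hα hmδ h2.integrable
      (by linarith [hlen k] : a + k * ℓ < a + ((k : ℝ) + 1) * ℓ) (hcell k hk) (by
        rw [hlen]; exact hsmall)
    rwa [hlen] at this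
  have hle_z : ∀ {h : ℝ}, 0 ≤ h → h ^ α < mδ / ℓ → h ≤ z := by
    intro h h0 hlt
    rw [← hzα] at hlt
    exact ((Real.rpow_lt_rpow_iff h0 (by positivity) hα0).1 hlt).le
  -- Any good point witnesses this, since h ≥ 1.
  have hz1 : 1 ≤ z := by
    obtain ⟨t, -, hfin, hlt⟩ := hgood 0 hN0
    have := one_le_toReal_mrProd hfin
    have := hle_z (by positivity) hlt
    linarith
  have hℓab : ℓ ≤ b - a := by
    rw [hℓ]
    exact div_le_self hT.le (by exact_mod_cast hN0)
  have hwp : WellPosed p ι A a b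
      ((2 + ENNReal.ofReal (2 * z * Real.exp ((4 * mη * z ^ (β + 1) + 1) * ℓ)) *
        (2 + 2 * ENNReal.ofReal L)) ^ N) := by
    have hb : a + N * ℓ = b := by rw [hNℓ]; ring
    have := WellPosed.iterate (p := p) (ι := ι) (A := A) (L := L) (a := a) (ℓ := ℓ) (N := N)
      (κ := ENNReal.ofReal (2 * z * Real.exp ((4 * mη * z ^ (β + 1) + 1) * ℓ)))
      hp.le hℓ0 hN0 (by rwa [hb]) (by rwa [hb]) (by
        intro k hk
        obtain ⟨t, ht, hfin, hlt⟩ := hgood k hk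
        have := h1.wellPosed_cell (z := z) hp hι hβ h2 hAL (hcell k hk) (by rwa [hlen]) ht hfin
          (by rwa [hlen]) (hle_z (by positivity) hlt)
        rwa [hlen] at this)
    rwa [hb] at this
  have hgraph : ∀ s ∈ Ioo a b, GraphNormEquiv ι (A s) := by
    intro s hs
    have hsa : 0 ≤ (s - a) / ℓ := div_nonneg (by linarith [hs.1]) hℓ0.le
    -- The half-open cell containing s. An s on a cell boundary is covered too, as only |t - s| ≤ ℓ
    -- is needed.
    set k := ⌊(s - a) / ℓ⌋₊ with hk
    have hk1 : k * ℓ ≤ s - a := (le_div_iff₀ hℓ0).1 (Nat.floor_le hsa)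
    have hk2 : s - a < (k + 1) * ℓ := (div_lt_iff₀ hℓ0).1 (Nat.lt_floor_add_one _)
    have hkN : k < N := by
      have : (k : ℝ) * ℓ < N * ℓ := by rw [hNℓ]; linarith [hs.2]
      exact_mod_cast lt_of_mul_lt_mul_right this hℓ0.le
    obtain ⟨t, ht, hfin, hlt⟩ := hgood k hkN
    refine h1.graphNormEquiv hp hab hs (hcell k hkN ht) hfin ?_
    have hh := one_le_toReal_mrProd hfin
    have hε := ε₀_eq (p := p) (ι := ι) (a := a) (b := b) (A₀ := A₀) t
    have hε0 : 0 < ε₀ p ι a b A₀ t := by rw [hε]; positivity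
    have hδ : ℓ ≤ δ (ε₀ p ι a b A₀ t) := by
      rw [h2.δ_eq _ hε0, hε, Real.div_rpow zero_le_one (by positivity), Real.one_rpow, mul_one_div,
        le_div_iff₀ (by positivity)]
      rw [lt_div_iff₀ hℓ0] at hlt
      linarith
    refine le_trans ?_ hδ
    rw [abs_le]
    constructor <;> linarith [ht.1, ht.2]
  have hfinκ : (2 + ENNReal.ofReal (2 * z * Real.exp ((4 * mη * z ^ (β + 1) + 1) * ℓ)) *
      (2 + 2 * ENNReal.ofReal L)) ^ N ≠ ⊤ :=
    ENNReal.pow_ne_top (ENNReal.add_ne_top.2 ⟨by simp, ENNReal.mul_ne_top ENNReal.ofReal_ne_top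
      (ENNReal.add_ne_top.2 ⟨by simp, ENNReal.mul_ne_top (by simp) ENNReal.ofReal_ne_top⟩)⟩)
  refine ⟨hwp.hasMR hp.le hab hAm hAL hfinκ hgraph, ?_⟩
  refine (log_mrConst_le hp.le hab hAm hAL hL0 hz1 (by positivity) hwp).trans ?_
  rw [EReal.coe_le_coe_iff, hNℓ]
  refine hC mδ mη G z N hmδ h2.mδ_le_one hmη hG0 hNle hz1 ?_
  rw [hzα, hℓ]
  field_simp

end MaxReg

end

/-! ### Choice of the constant. -/

open MaxReg in
theorem mainTheorem2 :
    ∃ C : ℝ → ℝ → ℝ → ℝ → ℝ → ℝ → ℝ,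
      ∀ (X : Type u) [NormedAddCommGroup X] [NormedSpace ℝ X] [CompleteSpace X]
        (D : Type v) [NormedAddCommGroup D] [NormedSpace ℝ D] [CompleteSpace D]
        (ι : D →L[ℝ] X), Function.Injective ι → DenseRange ι → IsCompactOperator ι →
      ∀ (p r α β : ℝ), 1 < p → 1 < r → 1 ≤ α → 0 ≤ β →
      ∀ (a b : ℝ), a < b →
      ∀ (A A₀ : ℝ → D →L[ℝ] X) (B : ℝ → ℝ → D →L[ℝ] X) (δ η : ℝ → ℝ) (mδ mη : ℝ),
        AssumptionA1 p ι a b A A₀ B δ η →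
        AssumptionA2 p r α β mδ mη ι a b A₀ δ η →
        HasMR p ι (Ioo a b) A ∧
        ENNReal.log (mrConst p ι (Ioo a b) A) ≤
          ((C (b - a) (opNormInf (Ioo a b) A) p r α β *
            (((Γ p r α ι a b A₀).toReal / mδ) ^ rStar r *
                (1 + mη * mδ ^ s₂ α β r * (Γ p r α ι a b A₀).toReal ^ s₁ α β r
                  + Real.log ((Γ p r α ι a b A₀).toReal / mδ))
              + mη + 1) : ℝ) : EReal) := by
  choose C hC using exists_const_log_bound
  classical
  -- The constant is chosen before the spaces and operators; the value 0 is taken only for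
  -- inadmissible parameters.
  refine ⟨fun T L _ r α β => if h : 0 < T ∧ 0 ≤ L ∧ 1 < r ∧ 1 ≤ α ∧ 0 ≤ β then
    C T L r α β h.1 h.2.1 h.2.2.1 h.2.2.2.1 h.2.2.2.2 else 0, ?_⟩
  intro X _ _ _ D _ _ _ ι hι _ _ p r α β hp hr hα hβ a b hab A A₀ B δ η mδ mη h1 h2
  have h : 0 < b - a ∧ 0 ≤ opNormInf (Ioo a b) A ∧ 1 < r ∧ 1 ≤ α ∧ 0 ≤ β :=
    ⟨sub_pos.2 hab, ENNReal.toReal_nonneg, hr, hα, hβ⟩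
  simp only [dif_pos h]
  exact main_estimate hι hp hr hα hβ hab h1 h2
    (hC _ _ r α β h.1 h.2.1 h.2.2.1 h.2.2.2.1 h.2.2.2.2)
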